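/- Let $p$ be a prime, $n\ge 1$, and let $S$ be a nonempty finite multiset of elements of $\mathbb Z_p^n$ in which $x$ and $-x$ have the same multiplicity for every $x$. Let $G=\mathrm{Cay}(\mathbb Z_p^n,S)$ be the undirected $|S|$-regular multigraph (loops allowed) on $\mathbb Z_p^n$ in which every vertex $v$ is joined to $v+s$ for each $s\in S$, counted with multiplicity. Its conductance is $$\phi(G)=\min_{Q}\frac{|\{(u,v)\in E(G):u\in Q,\ v\notin Q\}|}{\sum_{u\in Q}\deg_G(u)},$$ the minimum being over nonempty vertex sets $Q$ with $\mathrm{vol}(Q)\le \mathrm{vol}(G)/2$, where $\mathrm{vol}(Q)=\sum_{u\in Q}\deg_G(u)$ and $\mathrm{vol}(G)$ is the volume of the whole vertex set. Let $G'=\mathrm{Cay}(\mathbb Z_p^n,S')$, where $S'$ is the multiset of all multiples $ks$ with $s\in S$ and $1\le k\le (p-1)/2$ if $p$ is odd, and $S'=S$ if $p=2$. Let $\lambda_2(G')$ be the second smallest eigenvalue, counted with multiplicity, of the normalized Laplacian of $G'$. There is a polynomial-time $O(p)$-approximation algorithm for conductance on undirected Cayley graphs over $\mathbb Z_p^n$,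 namely the computation of $\lambda_2(G')$. Precisely, there are one random access machine program (uniform cost; the arithmetic instructions are addition and truncated subtraction of natural numbers), a polynomial $T$ and a constant $C>0$ such that for all $p$, $n$, $S$ as above: 1. on input $p$, $n$ and a list of the elements of $S$ (with repetitions, in any order), the program halts after at most $T(p^n+|S|)$ steps and outputs natural numbers $a$ and $b>0$ with $a/b=\lambda_2(G')$; 2. $\phi(G)\le\lambda_2(G')\le C\,p\,\phi(G)$; 3. if $p$ is odd, then moreover $\lambda_2(G')\le\frac{p+1}{2}\,\phi(G)$. -/

import Mathlib

/-! ### Undirected multigraphs with loops -/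

/-- A finite undirected graph, possibly with parallel edges and loops, given by the number of edges
joining each ordered pair of vertices (that is, by its unnormalized adjacency matrix).
A loop at `u` counted in `mult u u` contributes `1` to the degree of `u`. -/
structure MultiGraph (V : Type*) where
  mult : V → V → ℕ
  symm : ∀ u v, mult u v = mult v u

namespace MultiGraph

variable {V : Type*} [Fintype V] [DecidableEq V] (G : MultiGraph V)

/-- The degree of a vertex. -/
def deg (u : V) : ℕ := ∑ v, G.mult u v

/-- The volume of a set of vertices. -/
def vol (Q : Finset V) : ℕ := ∑ u ∈ Q, G.deg u

/-- The number of edges `(u, v)` with `u ∈ Q` and `v ∉ Q`. -/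
def cut (Q : Finset V) : ℕ := ∑ u ∈ Q, ∑ v ∈ Qᶜ, G.mult u v

/-- The conductance `φ_G(Q)` of a set of vertices. -/
noncomputable def setConductance (Q : Finset V) : ℝ := (G.cut Q : ℝ) / (G.vol Q : ℝ)

/-- The conductance `φ(G)`: the minimum of `φ_G(Q)` over the sets `Q` of positive volume with
`vol Q ≤ vol V / 2`. (The infimum is over finitely many values.) -/
noncomputable def conductance : ℝ :=
  sInf {x : ℝ | ∃ Q : Finset V, 0 < G.vol Q ∧ 2 * G.vol Q ≤ G.vol Finset.univ ∧
    x = G.setConductance Q}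

/-- The normalized adjacency matrix. -/
noncomputable def normAdj : Matrix V V ℝ :=
  Matrix.of fun u v => (G.mult u v : ℝ) / Real.sqrt ((G.deg u : ℝ) * (G.deg v : ℝ))

/-- The normalized Laplacian `I - A`. -/
noncomputable def normLap : Matrix V V ℝ := 1 - G.normAdj

theorem normLap_isHermitian : G.normLap.IsHermitian := by
  refine Matrix.isHermitian_one.sub ?_
  ext u v
  simp [normAdj, G.symm u v, mul_comm]

/-- `G.lambda k` is the `k`-th smallest eigenvalue (`1 ≤ k ≤ |V|`), counted with multiplicity, of
the normalized Laplacian. Mathlib's `eigenvalues₀` lists the eigenvalues in decreasing order. -/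
noncomputable def lambda (k : ℕ) : ℝ :=
  if h : 1 ≤ k ∧ k ≤ Fintype.card V then
    G.normLap_isHermitian.eigenvalues₀ ⟨Fintype.card V - k, by omega⟩
  else 0

end MultiGraph

/-! ### Cayley graphs of abelian groups -/

/-- A multiset of group elements in which `x` and `-x` have the same multiplicity for all `x`. -/
def SymmGens {Γ : Type*} [AddCommGroup Γ] [DecidableEq Γ] (S : Multiset Γ) : Prop :=
  ∀ x, S.count x = S.count (-x)

/-- The Cayley graph `Cay(Γ, S)`: every `v` is joined to `v + s` once for each `s ∈ S`, counted
with multiplicity. -/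
def cayley {Γ : Type*} [AddCommGroup Γ] [DecidableEq Γ] (S : Multiset Γ) (hS : SymmGens S) :
    MultiGraph Γ where
  mult u v := S.count (v - u)
  symm u v := by rw [hS (v - u), neg_sub]

/-- The multiset `⋃ kS` over `1 ≤ k ≤ (p - 1) / 2` for odd `p`, where `kS = {k s : s ∈ S}`
(note that `p / 2 = (p - 1) / 2` for odd `p`). For `p = 2` it is `S` itself. -/
def multiplesUpToHalf (p : ℕ) {Γ : Type*} [AddCommGroup Γ] (S : Multiset Γ) : Multiset Γ :=
  (Finset.Icc 1 (p / 2)).val.bind fun k => S.map fun s => k • s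

theorem symmGens_iff_map_neg {Γ : Type*} [AddCommGroup Γ] [DecidableEq Γ] (S : Multiset Γ) :
    SymmGens S ↔ S.map (fun s => -s) = S := by
  have key : ∀ x, (S.map (fun s => -s)).count x = S.count (-x) := by
    intro x
    have h := Multiset.count_map_eq_count' (fun s : Γ => -s) S neg_injective (-x)
    simpa using h
  constructor
  · intro h
    ext x
    rw [key, ← h x]
  · intro h x
    rw [← key, h]

theorem SymmGens.multiplesUpToHalf (p : ℕ) {Γ : Type*} [AddCommGroup Γ] [DecidableEq Γ]
    {S : Multiset Γ} (hS : SymmGens S) : SymmGens (multiplesUpToHalf p S) := by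
  rw [symmGens_iff_map_neg] at hS ⊢
  unfold _root_.multiplesUpToHalf
  rw [Multiset.map_bind]
  congr 1
  funext k
  conv_rhs => rw [← hS]
  simp [Multiset.map_map]

/-! ### Random access machines with uniform cost

The classical random access machine: memory cells holding natural numbers, addition and truncated
subtraction, indirect addressing, conditional jumps, an input tape and an output tape of natural
numbers. Every instruction costs one time unit. As there is no multiplication, polynomial time on
this machine is the same as polynomial time on a Turing machine. -/

namespace RAM

/-- Instructions; `X i` stands for the content of memory cell `i`. -/
inductive Instr where
  /-- `X i := c` -/
  | const (i c : ℕ)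
  /-- `X i := X j + X k` -/
  | add (i j k : ℕ)
  /-- `X i := X j - X k` (truncated at `0`) -/
  | sub (i j k : ℕ)
  /-- `X i := X (X j)` -/
  | load (i j : ℕ)
  /-- `X (X i) := X j` -/
  | store (i j : ℕ)
  /-- `X i :=` the next number on the input tape (`0` if there is none) -/
  | read (i : ℕ)
  /-- append `X i` to the output tape -/
  | print (i : ℕ)
  /-- go to instruction `t` -/
  | jump (t : ℕ)
  /-- go to instruction `t` if `X i = 0` -/
  | jumpZero (i t : ℕ)

/-- A program is a finite list of instructions, numbered from `0`. -/
abbrev Program := List Instr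

/-- A configuration: instruction counter, memory, unread input, and output so far. -/
structure Config where
  pc : ℕ
  mem : ℕ → ℕ
  input : List ℕ
  output : List ℕ

/-- The effect of executing a single instruction. -/
def exec (c : Config) : Instr → Config
  | .const i a => { c with pc := c.pc + 1, mem := Function.update c.mem i a }
  | .add i j k => { c with pc := c.pc + 1, mem := Function.update c.mem i (c.mem j + c.mem k) }
  | .sub i j k => { c with pc := c.pc + 1, mem := Function.update c.mem i (c.mem j - c.mem k) }
  | .load i j => { c with pc := c.pc + 1, mem := Function.update c.mem i (c.mem (c.mem j)) }
  | .store i j => { c with pc := c.pc + 1, mem := Function.update c.mem (c.mem i) (c.mem j) }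
  | .read i => { c with
      pc := c.pc + 1, mem := Function.update c.mem i (c.input.headD 0), input := c.input.tail }
  | .print i => { c with pc := c.pc + 1, output := c.output ++ [c.mem i] }
  | .jump t => { c with pc := t }
  | .jumpZero i t => { c with pc := if c.mem i = 0 then t else c.pc + 1 }

/-- One step. The machine has halted when the counter points outside the program. -/
def step (P : Program) (c : Config) : Config :=
  match P[c.pc]? with
  | some I => exec c I
  | none => c

/-- The initial configuration: all memory cells are `0`. -/
def init (input : List ℕ) : Config := ⟨0, fun _ => 0, input, []⟩

/-- On the given input, the program halts after at most `T` steps with the given output. -/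
def OutputsWithin (P : Program) (input output : List ℕ) (T : ℕ) : Prop :=
  ∃ t ≤ T, P.length ≤ ((step P)^[t] (init input)).pc ∧
    ((step P)^[t] (init input)).output = output

end RAM

/-- The input describing `Cay(ℤ_p^n, S)`: the numbers `p`, `n`, `|S|`, followed by the coordinates
(in `{0, …, p - 1}`) of the generators, which are listed with repetitions in any order. -/
def encodeGens {p n : ℕ} (gens : List (Fin n → ZMod p)) : List ℕ :=
  p :: n :: gens.length :: gens.flatMap fun s => List.ofFn fun j => (s j).val

/-!
The characters `x ↦ e(⟨α, x⟩ / p)` of `ℤ_p^n` diagonalize the normalized Laplacian of every Cayley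
graph (`normLap_mul_fourierMatrix`). For the graph `G'` with the generators `k s`, `1 ≤ k ≤ p / 2`,
the sum of a character over the multiples of a single `s` depends only on whether `⟨α, s⟩ = 0`
(`sum_stdAddChar_multiples`), so the eigenvalue at `α` is `p w(α) / ((p - 1) |S|)`, where `w(α)` is
the number of `s ∈ S` outside the hyperplane orthogonal to `α`. Hence
`λ₂(G') = p W / ((p - 1) |S|)` with `W = min_{α ≠ 0} w(α)` (`enlarged_lambda_two`).

*Lower bound.* The hyperplane orthogonal to a minimizing `α` contains at most half of the vertices,
and its conductance in `G` is exactly `W / |S| ≤ λ₂(G')` (`conductance_le`).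

*Upper bound.* Translating by `k s` amounts to `k` translations by `s`, so the cut of a set in `G'`
is at most `1 + ⋯ + p / 2` times its cut in `G` (`two_mul_cut_multiplesUpToHalf_le`), whereas the
degree grows by the factor `p / 2`. With the easy half of Cheeger's inequality for `G'`
(`mul_card_le_two_mul_cut`, from Parseval's identity) this gives `λ₂(G') ≤ (p / 2 + 1) φ(G)`, with
`p / 2` rounded down. So the constant `C = 1` suffices.

*Algorithm.* The vectors `α ≠ 0` are the base `p` digit vectors of the numbers `1, …, p ^ n - 1`.
The program runs through these numbers, counts for each of them the generators that are not
orthogonal to the digit vector, and keeps the minimum. It is written in a small structured language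
compiled to machine code; `RAM.Cmd.Runs` expresses total correctness together with a bound on the
number of steps, and `RAM.mainCmd_outputsWithin` is the resulting statement for the program.
-/

namespace RAM

/-! ### Structured programs -/

/-- The data of a configuration without the instruction counter. -/
structure State where
  mem : ℕ → ℕ
  input : List ℕ
  output : List ℕ

/-- The configuration with the given data and the given instruction counter. -/
def State.at (s : State) (pc : ℕ) : Config := ⟨pc, s.mem, s.input, s.output⟩

/-- The instructions other than jumps. -/
def Instr.Straight : Instr → Prop
  | .jump _ => False
  | .jumpZero _ _ => False
  | _ => True

instance : DecidablePred Instr.Straight := fun I => by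
  cases I <;> unfold Instr.Straight <;> infer_instance

/-- The effect of an instruction on the data. -/
def Instr.apply (s : State) (I : Instr) : State :=
  ⟨(exec (s.at 0) I).mem, (exec (s.at 0) I).input, (exec (s.at 0) I).output⟩

theorem exec_at (s : State) {I : Instr} (hI : I.Straight) (o : ℕ) :
    exec (s.at o) I = (I.apply s).at (o + 1) := by
  cases I <;> first | rfl | exact hI.elim

/-- Structured programs: straight-line blocks, composition, and loops `while X r ≠ 0 do b`. -/
inductive Cmd where
  | block (l : List Instr)
  | seq (a b : Cmd)
  | loop (r : ℕ) (b : Cmd)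

namespace Cmd

/-- The number of machine instructions of the compiled program. -/
def size : Cmd → ℕ
  | block l => l.length
  | seq a b => a.size + b.size
  | loop _ b => b.size + 2

/-- The machine code of a structured program, to be placed at address `o`. -/
def compile : Cmd → ℕ → Program
  | block l, _ => l
  | seq a b, o => a.compile o ++ b.compile (o + a.size)
  | loop r b, o => .jumpZero r (o + b.size + 2) :: (b.compile (o + 1) ++ [.jump o])

theorem length_compile (c : Cmd) (o : ℕ) : (c.compile o).length = c.size := by
  induction c generalizing o with
  | block l => rfl
  | seq a b iha ihb => simp [compile, size, iha, ihb]
  | loop r b ih => simp [compile, size, ih]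

/-- `c.Runs s s' T`: wherever the code of `c` is placed, the machine started at its first
instruction with data `s` arrives just behind the code with data `s'` after at most `T` steps. -/
def Runs (c : Cmd) (s s' : State) (T : ℕ) : Prop :=
  ∀ A B : Program, ∃ t ≤ T,
    (step (A ++ c.compile A.length ++ B))^[t] (s.at A.length) = s'.at (A.length + c.size)

theorem Runs.mono {c : Cmd} {s s' : State} {T T' : ℕ} (h : c.Runs s s' T) (hT : T ≤ T') :
    c.Runs s s' T' := fun A B => by
  obtain ⟨t, ht, h⟩ := h A B
  exact ⟨t, ht.trans hT, h⟩

theorem iterate_step_straight {l : List Instr} (hl : ∀ I ∈ l, I.Straight) (s : State)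
    (A B : Program) :
    (step (A ++ l ++ B))^[l.length] (s.at A.length) =
      (l.foldl Instr.apply s).at (A.length + l.length) := by
  induction l generalizing A s with
  | nil => simp
  | cons I l ih =>
    have h1 : step (A ++ I :: l ++ B) (s.at A.length) = (I.apply s).at (A.length + 1) := by
      have : (A ++ I :: l ++ B)[(s.at A.length).pc]? = some I := by simp [State.at]
      rw [step, this]
      exact exec_at s (hl I (by simp)) _
    have h2 := ih (fun J hJ => hl J (by simp [hJ])) (I.apply s) (A ++ [I])
    simp only [List.length_cons, Function.iterate_succ_apply, h1, List.foldl_cons]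
    simpa [Nat.add_assoc, Nat.add_comm 1] using h2

theorem Runs.block {l : List Instr} (hl : ∀ I ∈ l, I.Straight) {s s' : State}
    (hs : l.foldl Instr.apply s = s') : (Cmd.block l).Runs s s' l.length := fun A B =>
  ⟨l.length, le_rfl, hs ▸ iterate_step_straight hl s A B⟩

theorem Runs.seq {a b : Cmd} {s₁ s₂ s₃ : State} {T₁ T₂ : ℕ} (ha : a.Runs s₁ s₂ T₁)
    (hb : b.Runs s₂ s₃ T₂) : (a.seq b).Runs s₁ s₃ (T₁ + T₂) := fun A B => by
  obtain ⟨t₁, ht₁, h₁⟩ := ha A (b.compile (A.length + a.size) ++ B)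
  obtain ⟨t₂, ht₂, h₂⟩ := hb (A ++ a.compile A.length) B
  refine ⟨t₂ + t₁, by omega, ?_⟩
  simp only [List.length_append, length_compile] at h₂
  simp only [compile, size, Function.iterate_add_apply, ← Nat.add_assoc, ← List.append_assoc]
    at h₁ h₂ ⊢
  rw [h₁, h₂]

theorem Runs.loop_zero {r : ℕ} {b : Cmd} {s : State} (h : s.mem r = 0) :
    (Cmd.loop r b).Runs s s 1 := fun A B => by
  refine ⟨1, le_rfl, ?_⟩
  have : (A ++ (Cmd.loop r b).compile A.length ++ B)[(s.at A.length).pc]? =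
      some (.jumpZero r (A.length + b.size + 2)) := by simp [State.at, compile]
  rw [Function.iterate_one, step, this]
  simp [exec, State.at, h, size, Nat.add_assoc]

theorem Runs.loop_succ {r : ℕ} {b : Cmd} {s s' s'' : State} {T T' : ℕ} (h : s.mem r ≠ 0)
    (hb : b.Runs s s' T) (hl : (Cmd.loop r b).Runs s' s'' T') :
    (Cmd.loop r b).Runs s s'' (T' + (T + 2)) := fun A B => by
  obtain ⟨t, ht, h₁⟩ := hb (A ++ [.jumpZero r (A.length + b.size + 2)]) (.jump A.length :: B)
  obtain ⟨t', ht', h₂⟩ := hl A B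
  have hP : A ++ (Cmd.loop r b).compile A.length ++ B =
      A ++ [.jumpZero r (A.length + b.size + 2)] ++ b.compile (A.length + 1) ++
        .jump A.length :: B := by simp [compile]
  refine ⟨t' + (1 + (t + 1)), by omega, ?_⟩
  rw [Function.iterate_add_apply, Function.iterate_add_apply, Function.iterate_add_apply,
    Function.iterate_one]
  have e1 : step (A ++ (Cmd.loop r b).compile A.length ++ B) (s.at A.length) =
      s.at (A.length + 1) := by
    have : (A ++ (Cmd.loop r b).compile A.length ++ B)[(s.at A.length).pc]? =
        some (.jumpZero r (A.length + b.size + 2)) := by simp [State.at, compile]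
    rw [step, this]
    simp [exec, State.at, h]
  have e2 : step (A ++ (Cmd.loop r b).compile A.length ++ B) (s'.at (A.length + 1 + b.size)) =
      s'.at A.length := by
    have : (A ++ (Cmd.loop r b).compile A.length ++ B)[(s'.at (A.length + 1 + b.size)).pc]? =
        some (.jump A.length) := by
      rw [hP, List.getElem?_append_right (by simp [State.at, length_compile, Nat.add_assoc])]
      have : A.length + 1 + b.size - (A.length + (b.size + 1)) = 0 := by omega
      simp [State.at, length_compile, this]
    rw [step, this]
    rfl
  simp only [List.length_append, List.length_singleton, ← hP] at h₁
  rw [e1, h₁, e2, h₂]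

/-- A loop whose states at the successive tests are `f 0, …, f K`. -/
theorem Runs.loop {r : ℕ} {b : Cmd} {T : ℕ} (f : ℕ → State) (K : ℕ)
    (hne : ∀ k < K, (f k).mem r ≠ 0) (h0 : (f K).mem r = 0)
    (hb : ∀ k < K, b.Runs (f k) (f (k + 1)) T) :
    (Cmd.loop r b).Runs (f 0) (f K) (K * (T + 2) + 1) := by
  induction K generalizing f with
  | zero => simpa using Runs.loop_zero h0
  | succ K ih =>
    have := Runs.loop_succ (hne 0 (by omega)) (hb 0 (by omega))
      (ih (fun k => f (k + 1)) (fun k hk => hne _ (by omega)) h0 (fun k hk => hb _ (by omega)))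
    refine this.mono (le_of_eq ?_)
    ring

/-- The machine code of `c`, started in its initial configuration, halts behind the code. -/
theorem Runs.outputsWithin {c : Cmd} {input : List ℕ} {s' : State} {T : ℕ}
    (h : c.Runs ⟨fun _ => 0, input, []⟩ s' T) :
    OutputsWithin (c.compile 0) input s'.output T := by
  obtain ⟨t, ht, h⟩ := h [] []
  refine ⟨t, ht, ?_⟩
  simp only [List.nil_append, List.append_nil, List.length_nil] at h
  rw [show init input = State.at ⟨fun _ => 0, input, []⟩ 0 from rfl, h]
  simp [State.at, length_compile]

end Cmd

end RAM

namespace RAM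

/-! ### Memory layout -/

/-- The memory contents used by the program: cell `0` holds the constant `1`, cells `1` to `14`
hold the other registers, and the coordinates of the generators are stored from cell `15` on. -/
structure Registers where
  one : ℕ
  p : ℕ
  n : ℕ
  m : ℕ
  c : ℕ
  best : ℕ
  cnt : ℕ
  j : ℕ
  ptr : ℕ
  q : ℕ
  i : ℕ
  acc : ℕ
  x : ℕ
  k : ℕ
  t : ℕ
  data : ℕ → ℕ

/-- The memory with the given register contents. -/
def Registers.toMem (R : Registers) : ℕ → ℕ
  | 0 => R.one
  | 1 => R.p
  | 2 => R.n
  | 3 => R.m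
  | 4 => R.c
  | 5 => R.best
  | 6 => R.cnt
  | 7 => R.j
  | 8 => R.ptr
  | 9 => R.q
  | 10 => R.i
  | 11 => R.acc
  | 12 => R.x
  | 13 => R.k
  | 14 => R.t
  | a + 15 => R.data a

namespace Reg

/-! The addresses of the registers. -/

abbrev one : ℕ := 0
abbrev p : ℕ := 1
abbrev n : ℕ := 2
abbrev m : ℕ := 3
abbrev c : ℕ := 4
abbrev best : ℕ := 5
abbrev cnt : ℕ := 6
abbrev j : ℕ := 7
abbrev ptr : ℕ := 8
abbrev q : ℕ := 9
abbrev i : ℕ := 10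
abbrev acc : ℕ := 11
abbrev x : ℕ := 12
abbrev k : ℕ := 13
abbrev t : ℕ := 14

end Reg

namespace Registers

variable (R : Registers) (v : ℕ)

@[simp] theorem toMem_one : R.toMem 0 = R.one := rfl

@[simp] theorem toMem_p : R.toMem 1 = R.p := rfl

@[simp] theorem toMem_n : R.toMem 2 = R.n := rfl

@[simp] theorem toMem_m : R.toMem 3 = R.m := rfl

@[simp] theorem toMem_c : R.toMem 4 = R.c := rfl

@[simp] theorem toMem_best : R.toMem 5 = R.best := rfl

@[simp] theorem toMem_cnt : R.toMem 6 = R.cnt := rfl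

@[simp] theorem toMem_j : R.toMem 7 = R.j := rfl

@[simp] theorem toMem_ptr : R.toMem 8 = R.ptr := rfl

@[simp] theorem toMem_q : R.toMem 9 = R.q := rfl

@[simp] theorem toMem_i : R.toMem 10 = R.i := rfl

@[simp] theorem toMem_acc : R.toMem 11 = R.acc := rfl

@[simp] theorem toMem_x : R.toMem 12 = R.x := rfl

@[simp] theorem toMem_k : R.toMem 13 = R.k := rfl

@[simp] theorem toMem_t : R.toMem 14 = R.t := rfl

@[simp] theorem toMem_data (a : ℕ) : R.toMem (a + 15) = R.data a := rfl

@[simp] theorem update_one :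
    Function.update R.toMem 0 v = { R with one := v }.toMem := by
  funext a
  rcases a with _|_|_|_|_|_|_|_|_|_|_|_|_|_|_|a <;> simp [toMem]

@[simp] theorem update_p :
    Function.update R.toMem 1 v = { R with p := v }.toMem := by
  funext a
  rcases a with _|_|_|_|_|_|_|_|_|_|_|_|_|_|_|a <;> simp [toMem]

@[simp] theorem update_n :
    Function.update R.toMem 2 v = { R with n := v }.toMem := by
  funext a
  rcases a with _|_|_|_|_|_|_|_|_|_|_|_|_|_|_|a <;> simp [toMem]

@[simp] theorem update_m :
    Function.update R.toMem 3 v = { R with m := v }.toMem := by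
  funext a
  rcases a with _|_|_|_|_|_|_|_|_|_|_|_|_|_|_|a <;> simp [toMem]

@[simp] theorem update_c :
    Function.update R.toMem 4 v = { R with c := v }.toMem := by
  funext a
  rcases a with _|_|_|_|_|_|_|_|_|_|_|_|_|_|_|a <;> simp [toMem]

@[simp] theorem update_best :
    Function.update R.toMem 5 v = { R with best := v }.toMem := by
  funext a
  rcases a with _|_|_|_|_|_|_|_|_|_|_|_|_|_|_|a <;> simp [toMem]

@[simp] theorem update_cnt :
    Function.update R.toMem 6 v = { R with cnt := v }.toMem := by
  funext a
  rcases a with _|_|_|_|_|_|_|_|_|_|_|_|_|_|_|a <;> simp [toMem]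

@[simp] theorem update_j :
    Function.update R.toMem 7 v = { R with j := v }.toMem := by
  funext a
  rcases a with _|_|_|_|_|_|_|_|_|_|_|_|_|_|_|a <;> simp [toMem]

@[simp] theorem update_ptr :
    Function.update R.toMem 8 v = { R with ptr := v }.toMem := by
  funext a
  rcases a with _|_|_|_|_|_|_|_|_|_|_|_|_|_|_|a <;> simp [toMem]

@[simp] theorem update_q :
    Function.update R.toMem 9 v = { R with q := v }.toMem := by
  funext a
  rcases a with _|_|_|_|_|_|_|_|_|_|_|_|_|_|_|a <;> simp [toMem]

@[simp] theorem update_i :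
    Function.update R.toMem 10 v = { R with i := v }.toMem := by
  funext a
  rcases a with _|_|_|_|_|_|_|_|_|_|_|_|_|_|_|a <;> simp [toMem]

@[simp] theorem update_acc :
    Function.update R.toMem 11 v = { R with acc := v }.toMem := by
  funext a
  rcases a with _|_|_|_|_|_|_|_|_|_|_|_|_|_|_|a <;> simp [toMem]

@[simp] theorem update_x :
    Function.update R.toMem 12 v = { R with x := v }.toMem := by
  funext a
  rcases a with _|_|_|_|_|_|_|_|_|_|_|_|_|_|_|a <;> simp [toMem]

@[simp] theorem update_k :
    Function.update R.toMem 13 v = { R with k := v }.toMem := by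
  funext a
  rcases a with _|_|_|_|_|_|_|_|_|_|_|_|_|_|_|a <;> simp [toMem]

@[simp] theorem update_t :
    Function.update R.toMem 14 v = { R with t := v }.toMem := by
  funext a
  rcases a with _|_|_|_|_|_|_|_|_|_|_|_|_|_|_|a <;> simp [toMem]

@[simp] theorem update_data (a : ℕ) :
    Function.update R.toMem (a + 15) v =
      { R with data := Function.update R.data a v }.toMem := by
  funext b
  rcases b with _|_|_|_|_|_|_|_|_|_|_|_|_|_|_|b <;> simp [Function.update_apply, toMem]

end Registers


/-- The state with the given registers, remaining input and output. -/
def Registers.state (R : Registers) (input output : List ℕ) : State := ⟨R.toMem, input, output⟩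

@[simp] theorem Registers.state_mem (R : Registers) (u w : List ℕ) :
    (R.state u w).mem = R.toMem := rfl

@[simp] theorem Registers.state_output (R : Registers) (u w : List ℕ) :
    (R.state u w).output = w := rfl

@[simp] theorem apply_const (R : Registers) (u w : List ℕ) (i a : ℕ) :
    Instr.apply (R.state u w) (.const i a) = ⟨Function.update R.toMem i a, u, w⟩ := rfl

@[simp] theorem apply_add (R : Registers) (u w : List ℕ) (i j k : ℕ) :
    Instr.apply (R.state u w) (.add i j k) =
      ⟨Function.update R.toMem i (R.toMem j + R.toMem k), u, w⟩ := rfl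

@[simp] theorem apply_sub (R : Registers) (u w : List ℕ) (i j k : ℕ) :
    Instr.apply (R.state u w) (.sub i j k) =
      ⟨Function.update R.toMem i (R.toMem j - R.toMem k), u, w⟩ := rfl

@[simp] theorem apply_load (R : Registers) (u w : List ℕ) (i j : ℕ) :
    Instr.apply (R.state u w) (.load i j) =
      ⟨Function.update R.toMem i (R.toMem (R.toMem j)), u, w⟩ := rfl

@[simp] theorem apply_store (R : Registers) (u w : List ℕ) (i j : ℕ) :
    Instr.apply (R.state u w) (.store i j) =
      ⟨Function.update R.toMem (R.toMem i) (R.toMem j), u, w⟩ := rfl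

@[simp] theorem apply_read (R : Registers) (u w : List ℕ) (i : ℕ) :
    Instr.apply (R.state u w) (.read i) =
      ⟨Function.update R.toMem i (u.headD 0), u.tail, w⟩ := rfl

@[simp] theorem apply_print (R : Registers) (u w : List ℕ) (i : ℕ) :
    Instr.apply (R.state u w) (.print i) = R.state u (w ++ [R.toMem i]) := rfl

@[simp] theorem Registers.mk_state (R : Registers) (u w : List ℕ) :
    State.mk R.toMem u w = R.state u w := rfl

/-! ### Arithmetic subroutines -/

open Cmd

/-- Division with remainder: adds `k / p` to `q` and replaces `k` by `k % p`. The register `t` holds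
the truncated difference `k + 1 - p`, which is nonzero exactly while `p ≤ k`. -/
def divMod : Cmd :=
  .seq (.block [.add Reg.t Reg.k Reg.one, .sub Reg.t Reg.t Reg.p])
    (.loop Reg.t (.block [.sub Reg.k Reg.k Reg.p, .add Reg.q Reg.q Reg.one,
      .add Reg.t Reg.k Reg.one, .sub Reg.t Reg.t Reg.p]))

theorem divMod_runs (p n m c best cnt j ptr q i acc x k t : ℕ) (data : ℕ → ℕ) (u w : List ℕ)
    (hp : 0 < p) :
    divMod.Runs
      (Registers.state ⟨1, p, n, m, c, best, cnt, j, ptr, q, i, acc, x, k, t, data⟩ u w)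
      (Registers.state ⟨1, p, n, m, c, best, cnt, j, ptr, q + k / p, i, acc, x, k % p, 0, data⟩ u w)
      (6 * k + 3) := by
  let f : ℕ → State := fun l =>
    Registers.state ⟨1, p, n, m, c, best, cnt, j, ptr, q + l, i, acc, x, k - l * p,
      k - l * p + 1 - p, data⟩ u w
  have h1 : (Cmd.block [.add Reg.t Reg.k Reg.one, .sub Reg.t Reg.t Reg.p]).Runs
      (Registers.state ⟨1, p, n, m, c, best, cnt, j, ptr, q, i, acc, x, k, t, data⟩ u w)
      (f 0) 2 := Runs.block (by decide) (by simp [f])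
  have hmod : k - k / p * p = k % p := by
    have := Nat.div_add_mod' k p
    omega
  have h2 := Runs.loop (r := Reg.t) (b := .block [.sub Reg.k Reg.k Reg.p,
      .add Reg.q Reg.q Reg.one, .add Reg.t Reg.k Reg.one, .sub Reg.t Reg.t Reg.p]) (T := 4)
      f (k / p) ?_ ?_ ?_
  · have ht : k % p + 1 - p = 0 := by
      have := Nat.mod_lt k hp
      omega
    have h3 := (h1.seq h2).mono (T' := 6 * k + 3) (by
      have := Nat.div_le_self k p
      generalize k / p = a at *
      omega)
    simpa only [f, hmod, ht, divMod] using h3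
  · intro l hl
    have : (l + 1) * p ≤ k := (Nat.mul_le_mul_right p hl).trans (Nat.div_mul_le_self k p)
    have : l * p + p ≤ k := by linarith
    simp [f]
    omega
  · have := Nat.mod_lt k hp
    simp [f, hmod]
    omega
  · intro l hl
    have e : k - l * p - p = k - (l + 1) * p := by
      rw [Nat.add_mul, one_mul]
      omega
    exact Runs.block (by decide) (by simp [f, e, Nat.add_assoc])

/-- Multiplication: adds `k * x` to `acc`. -/
def mulAdd : Cmd :=
  .loop Reg.k (.block [.sub Reg.k Reg.k Reg.one, .add Reg.acc Reg.acc Reg.x])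

theorem mulAdd_runs (p n m c best cnt j ptr q i acc x k t : ℕ) (data : ℕ → ℕ) (u w : List ℕ) :
    mulAdd.Runs
      (Registers.state ⟨1, p, n, m, c, best, cnt, j, ptr, q, i, acc, x, k, t, data⟩ u w)
      (Registers.state ⟨1, p, n, m, c, best, cnt, j, ptr, q, i, acc + k * x, x, 0, t, data⟩ u w)
      (4 * k + 1) := by
  let f : ℕ → State := fun l =>
    Registers.state ⟨1, p, n, m, c, best, cnt, j, ptr, q, i, acc + l * x, x, k - l, t, data⟩ u w
  have h := Runs.loop (r := Reg.k) (b := .block [.sub Reg.k Reg.k Reg.one,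
      .add Reg.acc Reg.acc Reg.x]) (T := 2) f k ?_ ?_ ?_
  · simpa [f, mulAdd, mul_comm] using h
  · intro l hl
    simp [f]
    omega
  · simp [f]
  · intro l hl
    have e : acc + l * x + x = acc + (l + 1) * x := by ring
    exact Runs.block (by decide) (by simp [f, e, Nat.sub_sub])

end RAM

namespace RAM

open Cmd

/-! ### The program -/

/-- The number `∑_{l < k} c_l d_l`, where `c_l` are the base `p` digits of `c`. -/
def digitDot (p c : ℕ) (d : ℕ → ℕ) (k : ℕ) : ℕ := ∑ l ∈ Finset.range k, c / p ^ l % p * d l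

/-- The number of the first `k` vectors (consecutive blocks of length `n` in `data`) whose inner
product with the digit vector of `c` does not vanish modulo `p`. -/
def nonzeroCount (p n c : ℕ) (data : ℕ → ℕ) (k : ℕ) : ℕ :=
  ∑ j ∈ Finset.range k,
    if digitDot p c (fun l => data (j * n + l)) n % p = 0 then 0 else 1

/-- The minimum of `m` and the first `k` of the values `nonzeroCount … c`, `c = M, M - 1, …`. -/
def minCount (p n m : ℕ) (data : ℕ → ℕ) (M : ℕ) : ℕ → ℕ
  | 0 => m
  | k + 1 => min (minCount p n m data M k) (nonzeroCount p n (M - k) data m)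

/-- One step of the computation of an inner product: split off the last base `p` digit of `q`,
multiply it with the next coordinate, and add the product to `acc`. -/
def digitStep : Cmd :=
  .seq (.block [.sub Reg.i Reg.i Reg.one, .load Reg.x Reg.ptr, .add Reg.ptr Reg.ptr Reg.one,
    .const Reg.k 0, .add Reg.k Reg.k Reg.q, .const Reg.q 0])
  (.seq divMod (.seq mulAdd (.block [.const Reg.x 0])))

theorem digitStep_runs (p n m c best cnt j a q i acc : ℕ) (data : ℕ → ℕ) (u w : List ℕ)
    (hp : 0 < p) :
    digitStep.Runs
      (Registers.state ⟨1, p, n, m, c, best, cnt, j, a + 15, q, i + 1, acc, 0, 0, 0, data⟩ u w)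
      (Registers.state ⟨1, p, n, m, c, best, cnt, j, a + 1 + 15, q / p, i,
        acc + q % p * data a, 0, 0, 0, data⟩ u w)
      (10 * q + 11) := by
  have h1 : (Cmd.block [.sub Reg.i Reg.i Reg.one, .load Reg.x Reg.ptr,
      .add Reg.ptr Reg.ptr Reg.one, .const Reg.k 0, .add Reg.k Reg.k Reg.q,
      .const Reg.q 0]).Runs
      (Registers.state ⟨1, p, n, m, c, best, cnt, j, a + 15, q, i + 1, acc, 0, 0, 0, data⟩ u w)
      (Registers.state ⟨1, p, n, m, c, best, cnt, j, a + 15 + 1, 0, i, acc, data a, q, 0, data⟩ u w)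
      6 := Runs.block (by decide) (by simp)
  have h2 := divMod_runs p n m c best cnt j (a + 15 + 1) 0 i acc (data a) q 0 data u w hp
  have h3 := mulAdd_runs p n m c best cnt j (a + 15 + 1) (0 + q / p) i acc (data a) (q % p) 0
    data u w
  refine (h1.seq (h2.seq (h3.seq (Runs.block (l := [.const Reg.x 0]) (by decide)
    (by simp [Nat.add_right_comm]))))).mono ?_
  have := Nat.mod_le q p
  simp only [List.length_cons, List.length_nil]
  omega

/-- Test whether the inner product of the digit vector of `c` with the next generator vanishes
modulo `p`, and update `cnt` accordingly: the increment `1 - (1 - k)`, truncated, is `0` if the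
residue `k` is `0` and `1` otherwise. -/
def generatorStep : Cmd :=
  .seq (.block [.sub Reg.j Reg.j Reg.one, .add Reg.q Reg.q Reg.c, .add Reg.i Reg.i Reg.n])
  (.seq (.loop Reg.i digitStep)
  (.seq (.block [.add Reg.k Reg.k Reg.acc])
  (.seq divMod
  (.block [.sub Reg.t Reg.one Reg.k, .sub Reg.t Reg.one Reg.t, .add Reg.cnt Reg.cnt Reg.t,
    .const Reg.q 0, .const Reg.acc 0, .const Reg.k 0, .const Reg.t 0]))))

theorem digitDot_le {p n c : ℕ} {d : ℕ → ℕ} (hp : 0 < p) (hd : ∀ l, d l ≤ p) :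
    digitDot p c d n ≤ n * (p * p) := by
  unfold digitDot
  refine (Finset.sum_le_card_nsmul _ _ (p * p) fun l _ => ?_).trans (by simp)
  exact Nat.mul_le_mul (Nat.mod_lt _ hp).le (hd l)

theorem generatorStep_runs (p n m c best cnt j k : ℕ) (data : ℕ → ℕ) (u w : List ℕ)
    (hp : 0 < p) (hd : ∀ a, data a ≤ p) :
    generatorStep.Runs
      (Registers.state ⟨1, p, n, m, c, best, cnt, j + 1, k * n + 15, 0, 0, 0, 0, 0, 0, data⟩ u w)
      (Registers.state ⟨1, p, n, m, c, best,
        cnt + (if digitDot p c (fun l => data (k * n + l)) n % p = 0 then 0 else 1), j,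
        (k + 1) * n + 15, 0, 0, 0, 0, 0, 0, data⟩ u w)
      (n * (10 * c + 13) + 6 * (n * (p * p)) + 15) := by
  -- The state after `l` coordinates: the remaining digits of `c` are in `q`.
  let f : ℕ → State := fun l =>
    Registers.state ⟨1, p, n, m, c, best, cnt, j, k * n + l + 15, c / p ^ l, n - l,
      digitDot p c (fun l => data (k * n + l)) l, 0, 0, 0, data⟩ u w
  set A := digitDot p c (fun l => data (k * n + l)) n with hA
  have hA' : A ≤ n * (p * p) := digitDot_le hp fun _ => hd _
  have h1 : (Cmd.block [.sub Reg.j Reg.j Reg.one, .add Reg.q Reg.q Reg.c,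
      .add Reg.i Reg.i Reg.n]).Runs
      (Registers.state ⟨1, p, n, m, c, best, cnt, j + 1, k * n + 15, 0, 0, 0, 0, 0, 0, data⟩ u w)
      (f 0) 3 := Runs.block (by decide) (by simp [f, digitDot])
  have h2 : (Cmd.loop Reg.i digitStep).Runs (f 0) (f n) (n * (10 * c + 11 + 2) + 1) := by
    refine Runs.loop f n ?_ (by simp [f]) ?_
    · intro l hl
      simp [f]
      omega
    · intro l hl
      have h := digitStep_runs p n m c best cnt j (k * n + l) (c / p ^ l) (n - (l + 1))
        (digitDot p c (fun l => data (k * n + l)) l) data u w hp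
      rw [show n - (l + 1) + 1 = n - l by omega, Nat.div_div_eq_div_mul, ← pow_succ] at h
      have e : digitDot p c (fun l => data (k * n + l)) (l + 1) =
          digitDot p c (fun l => data (k * n + l)) l + c / p ^ l % p * data (k * n + l) := by
        simp [digitDot, Finset.sum_range_succ]
      have hT := Nat.div_le_self c (p ^ l)
      simp only [f, e]
      exact h.mono (by omega)
  have h3 : (Cmd.block [.add Reg.k Reg.k Reg.acc]).Runs (f n)
      (Registers.state ⟨1, p, n, m, c, best, cnt, j, k * n + n + 15, c / p ^ n, 0, A, 0, A, 0,
        data⟩ u w) 1 := Runs.block (by decide) (by simp [f, hA])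
  have h4 := divMod_runs p n m c best cnt j (k * n + n + 15) (c / p ^ n) 0 A 0 A 0 data u w hp
  have h5 : (Cmd.block [.sub Reg.t Reg.one Reg.k, .sub Reg.t Reg.one Reg.t,
      .add Reg.cnt Reg.cnt Reg.t, .const Reg.q 0, .const Reg.acc 0, .const Reg.k 0,
      .const Reg.t 0]).Runs
      (Registers.state ⟨1, p, n, m, c, best, cnt, j, k * n + n + 15, c / p ^ n + A / p, 0, A, 0,
        A % p, 0, data⟩ u w)
      (Registers.state ⟨1, p, n, m, c, best, cnt + (if A % p = 0 then 0 else 1), j,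
        (k + 1) * n + 15, 0, 0, 0, 0, 0, 0, data⟩ u w) 7 := by
    have e : 1 - (1 - A % p) = if A % p = 0 then 0 else 1 := by split <;> omega
    exact Runs.block (by decide) (by simp [e, Nat.add_mul])
  refine (h1.seq (h2.seq (h3.seq (h4.seq h5)))).mono ?_
  generalize n * (p * p) = b at *
  rw [show 10 * c + 11 + 2 = 10 * c + 13 by ring]
  generalize n * (10 * c + 13) = d at *
  omega

/-- Count the generators not orthogonal to the digit vector of `c`, take the minimum with the
best value so far, and pass to `c - 1`. With truncated subtraction,
`min best cnt = best - (best - cnt)`. -/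
def candidateStep : Cmd :=
  .seq (.block [.const Reg.ptr 15, .add Reg.j Reg.j Reg.m])
  (.seq (.loop Reg.j generatorStep)
  (.block [.sub Reg.t Reg.best Reg.cnt, .sub Reg.best Reg.best Reg.t, .sub Reg.c Reg.c Reg.one,
    .const Reg.cnt 0, .const Reg.ptr 0, .const Reg.t 0]))

theorem candidateStep_runs (p n m c best : ℕ) (data : ℕ → ℕ) (u w : List ℕ)
    (hp : 0 < p) (hd : ∀ a, data a ≤ p) :
    candidateStep.Runs
      (Registers.state ⟨1, p, n, m, c, best, 0, 0, 0, 0, 0, 0, 0, 0, 0, data⟩ u w)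
      (Registers.state ⟨1, p, n, m, c - 1, min best (nonzeroCount p n c data m),
        0, 0, 0, 0, 0, 0, 0, 0, 0, data⟩ u w)
      (m * (n * (10 * c + 13) + 6 * (n * (p * p)) + 17) + 9) := by
  let f : ℕ → State := fun l =>
    Registers.state ⟨1, p, n, m, c, best, nonzeroCount p n c data l, m - l, l * n + 15,
      0, 0, 0, 0, 0, 0, data⟩ u w
  have h1 : (Cmd.block [.const Reg.ptr 15, .add Reg.j Reg.j Reg.m]).Runs
      (Registers.state ⟨1, p, n, m, c, best, 0, 0, 0, 0, 0, 0, 0, 0, 0, data⟩ u w)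
      (f 0) 2 := Runs.block (by decide) (by simp [f, nonzeroCount])
  have h2 : (Cmd.loop Reg.j generatorStep).Runs (f 0) (f m)
      (m * (n * (10 * c + 13) + 6 * (n * (p * p)) + 15 + 2) + 1) := by
    refine Runs.loop f m ?_ (by simp [f]) ?_
    · intro l hl
      simp [f]
      omega
    · intro l hl
      have h := generatorStep_runs p n m c best (nonzeroCount p n c data l) (m - (l + 1)) l
        data u w hp hd
      rw [show m - (l + 1) + 1 = m - l by omega] at h
      simpa only [f, nonzeroCount, Finset.sum_range_succ] using h
  have h3 : (Cmd.block [.sub Reg.t Reg.best Reg.cnt, .sub Reg.best Reg.best Reg.t,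
      .sub Reg.c Reg.c Reg.one, .const Reg.cnt 0, .const Reg.ptr 0, .const Reg.t 0]).Runs (f m)
      (Registers.state ⟨1, p, n, m, c - 1, min best (nonzeroCount p n c data m),
        0, 0, 0, 0, 0, 0, 0, 0, 0, data⟩ u w) 6 := by
    have e : best - (best - nonzeroCount p n c data m) =
        min best (nonzeroCount p n c data m) := by omega
    exact Runs.block (by decide) (by simp [f, e])
  refine (h1.seq (h2.seq h3)).mono (le_of_eq ?_)
  ring

/-- Let `c` run from its initial value down to `1`. -/
def search : Cmd := .loop Reg.c candidateStep

theorem search_runs (p n m M : ℕ) (data : ℕ → ℕ) (u w : List ℕ)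
    (hp : 0 < p) (hd : ∀ a, data a ≤ p) :
    search.Runs
      (Registers.state ⟨1, p, n, m, M, m, 0, 0, 0, 0, 0, 0, 0, 0, 0, data⟩ u w)
      (Registers.state ⟨1, p, n, m, 0, minCount p n m data M M,
        0, 0, 0, 0, 0, 0, 0, 0, 0, data⟩ u w)
      (M * (m * (n * (10 * M + 13) + 6 * (n * (p * p)) + 17) + 11) + 1) := by
  let f : ℕ → State := fun l =>
    Registers.state ⟨1, p, n, m, M - l, minCount p n m data M l, 0, 0, 0, 0, 0, 0, 0, 0, 0,
      data⟩ u w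
  have h : (Cmd.loop Reg.c candidateStep).Runs (f 0) (f M)
      (M * (m * (n * (10 * M + 13) + 6 * (n * (p * p)) + 17) + 9 + 2) + 1) := by
    refine Runs.loop f M ?_ (by simp [f]) ?_
    · intro l hl
      simp [f]
      omega
    · intro l hl
      have h := candidateStep_runs p n m (M - l) (minCount p n m data M l) data u w hp hd
      simp only [f, minCount, ← Nat.sub_sub]
      refine h.mono ?_
      gcongr
      omega
  simpa [f, search, minCount] using h

/-- Read the numbers `p`, `n`, `m`, and then `m` vectors of length `n`. -/
def readInput : Cmd :=
  .seq (.block [.const Reg.one 1, .read Reg.p, .read Reg.n, .read Reg.m, .const Reg.ptr 15,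
    .add Reg.j Reg.j Reg.m])
  (.loop Reg.j (.seq (.block [.sub Reg.j Reg.j Reg.one, .add Reg.i Reg.i Reg.n])
    (.loop Reg.i (.block [.sub Reg.i Reg.i Reg.one, .read Reg.x, .store Reg.ptr Reg.x,
      .add Reg.ptr Reg.ptr Reg.one, .const Reg.x 0]))))

/-- The data cells after the first `a` numbers of `L` have been stored. -/
def stored (L : List ℕ) (a : ℕ) : ℕ → ℕ := fun b => if b < a then L.getD b 0 else 0

theorem stored_zero (L : List ℕ) : stored L 0 = fun _ => 0 := by
  funext b
  simp [stored]

theorem stored_succ (L : List ℕ) (a : ℕ) :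
    stored L (a + 1) = Function.update (stored L a) a ((L.drop a).headD 0) := by
  funext b
  have : (L.drop a).headD 0 = L.getD a 0 := by
    simp [List.headD_eq_head?_getD, List.head?_drop]
  rw [this]
  by_cases h : b = a
  · subst h
    simp [stored]
  · have : b < a + 1 ↔ b < a := by omega
    simp [stored, h, this]

theorem readInput_runs (p n m : ℕ) (L : List ℕ) (w : List ℕ) :
    readInput.Runs ⟨fun _ => 0, p :: n :: m :: L, w⟩
      (Registers.state ⟨1, p, n, m, 0, 0, 0, 0, m * n + 15, 0, 0, 0, 0, 0, 0,
        stored L (m * n)⟩ (L.drop (m * n)) w)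
      (m * (n * 7 + 5) + 7) := by
  let g : ℕ → ℕ → ℕ → State := fun j a i =>
    Registers.state ⟨1, p, n, m, 0, 0, 0, j, a + 15, 0, i, 0, 0, 0, 0, stored L a⟩ (L.drop a) w
  have h1 : (Cmd.block [.const Reg.one 1, .read Reg.p, .read Reg.n, .read Reg.m,
      .const Reg.ptr 15, .add Reg.j Reg.j Reg.m]).Runs ⟨fun _ => 0, p :: n :: m :: L, w⟩
      (g m 0 0) 6 := by
    have e : (⟨fun _ => 0, p :: n :: m :: L, w⟩ : State) =
        Registers.state ⟨0, 0, 0, 0, 0, 0, 0, 0, 0, 0, 0, 0, 0, 0, 0, fun _ => 0⟩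
          (p :: n :: m :: L) w := by
      refine congrArg (fun f => State.mk f _ _) (funext fun a => ?_)
      rcases a with _|_|_|_|_|_|_|_|_|_|_|_|_|_|_|a <;> rfl
    rw [e]
    exact Runs.block (by decide) (by simp [g, stored_zero])
  have h2 : ∀ j a, (Cmd.seq (.block [.sub Reg.j Reg.j Reg.one, .add Reg.i Reg.i Reg.n])
      (.loop Reg.i (.block [.sub Reg.i Reg.i Reg.one, .read Reg.x, .store Reg.ptr Reg.x,
      .add Reg.ptr Reg.ptr Reg.one, .const Reg.x 0]))).Runs (g (j + 1) a 0) (g j (a + n) 0)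
      (n * 7 + 3) := by
    intro j a
    have h3 : (Cmd.block [.sub Reg.j Reg.j Reg.one, .add Reg.i Reg.i Reg.n]).Runs
      (g (j + 1) a 0) (g j a n) 2 := Runs.block (by decide) (by simp [g])
    have h4 := Runs.loop (r := Reg.i) (b := .block [.sub Reg.i Reg.i Reg.one, .read Reg.x,
      .store Reg.ptr Reg.x, .add Reg.ptr Reg.ptr Reg.one, .const Reg.x 0]) (T := 5)
      (fun l => g j (a + l) (n - l)) n ?_ (by simp [g]) ?_
    · simp only [Nat.add_zero, Nat.sub_zero, Nat.sub_self] at h4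
      refine (h3.seq h4).mono (le_of_eq ?_)
      ring
    · intro l hl
      simp [g]
      omega
    · intro l hl
      exact Runs.block (by decide)
        (by simp [g, ← Nat.add_assoc, stored_succ, Nat.sub_sub, Nat.add_right_comm])
  have h5 := Runs.loop (r := Reg.j) (fun l => g (m - l) (l * n) 0) m
    (fun l hl => by simp [g]; omega) (by simp [g]) (fun l hl => by
      have h := h2 (m - (l + 1)) (l * n)
      rw [show m - (l + 1) + 1 = m - l by omega] at h
      simpa only [Nat.add_mul, one_mul] using h)
  simp only [Nat.sub_zero, Nat.zero_mul, Nat.sub_self] at h5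
  refine (h1.seq h5).mono (le_of_eq ?_)
  ring

/-- Set `acc` to `p ^ n`. -/
def power : Cmd :=
  .seq (.block [.const Reg.ptr 0, .const Reg.acc 1, .add Reg.i Reg.i Reg.n])
  (.loop Reg.i (.seq (.block [.sub Reg.i Reg.i Reg.one, .add Reg.x Reg.x Reg.acc,
    .const Reg.acc 0, .add Reg.k Reg.k Reg.p]) (.seq mulAdd (.block [.const Reg.x 0]))))

theorem power_runs (p n m a : ℕ) (data : ℕ → ℕ) (u w : List ℕ) :
    power.Runs
      (Registers.state ⟨1, p, n, m, 0, 0, 0, 0, a, 0, 0, 0, 0, 0, 0, data⟩ u w)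
      (Registers.state ⟨1, p, n, m, 0, 0, 0, 0, 0, 0, 0, p ^ n, 0, 0, 0, data⟩ u w)
      (n * (4 * p + 8) + 4) := by
  let f : ℕ → State := fun l =>
    Registers.state ⟨1, p, n, m, 0, 0, 0, 0, 0, 0, n - l, p ^ l, 0, 0, 0, data⟩ u w
  have h1 : (Cmd.block [.const Reg.ptr 0, .const Reg.acc 1, .add Reg.i Reg.i Reg.n]).Runs
      (Registers.state ⟨1, p, n, m, 0, 0, 0, 0, a, 0, 0, 0, 0, 0, 0, data⟩ u w) (f 0) 3 :=
    Runs.block (by decide) (by simp [f])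
  have h2 : (Cmd.loop Reg.i (.seq (.block [.sub Reg.i Reg.i Reg.one, .add Reg.x Reg.x Reg.acc,
      .const Reg.acc 0, .add Reg.k Reg.k Reg.p]) (.seq mulAdd (.block [.const Reg.x 0])))).Runs
      (f 0) (f n) (n * (4 * p + 6 + 2) + 1) := by
    refine Runs.loop f n ?_ (by simp [f]) ?_
    · intro l hl
      simp [f]
      omega
    · intro l hl
      have h3 : (Cmd.block [.sub Reg.i Reg.i Reg.one, .add Reg.x Reg.x Reg.acc,
          .const Reg.acc 0, .add Reg.k Reg.k Reg.p]).Runs (f l)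
          (Registers.state ⟨1, p, n, m, 0, 0, 0, 0, 0, 0, n - l - 1, 0, p ^ l, p, 0, data⟩ u w)
          4 := Runs.block (by decide) (by simp [f])
      have h4 := mulAdd_runs p n m 0 0 0 0 0 0 (n - l - 1) 0 (p ^ l) p 0 data u w
      refine (h3.seq (h4.seq (Runs.block (l := [.const Reg.x 0]) (by decide)
        (s' := f (l + 1)) (by simp [f, pow_succ', Nat.sub_sub])))).mono ?_
      simp only [List.length_cons, List.length_nil]
      omega
  have h := (h1.seq h2).mono (T' := n * (4 * p + 8) + 4) (le_of_eq (by ring))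
  simpa only [f, Nat.sub_self, power] using h

/-- Print `p * best` and `(p - 1) * m`. -/
def writeOutput : Cmd :=
  .seq (.block [.add Reg.k Reg.k Reg.best, .add Reg.x Reg.x Reg.p])
  (.seq mulAdd
  (.seq (.block [.print Reg.acc, .const Reg.acc 0, .sub Reg.k Reg.p Reg.one, .const Reg.x 0,
    .add Reg.x Reg.x Reg.m])
  (.seq mulAdd (.block [.print Reg.acc]))))

theorem writeOutput_runs (p n m b : ℕ) (data : ℕ → ℕ) (u : List ℕ) :
    ∃ s', s'.output = [b * p, (p - 1) * m] ∧ writeOutput.Runs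
      (Registers.state ⟨1, p, n, m, 0, b, 0, 0, 0, 0, 0, 0, 0, 0, 0, data⟩ u []) s'
      (4 * b + 4 * p + 10) := by
  have h1 : (Cmd.block [.add Reg.k Reg.k Reg.best, .add Reg.x Reg.x Reg.p]).Runs
      (Registers.state ⟨1, p, n, m, 0, b, 0, 0, 0, 0, 0, 0, 0, 0, 0, data⟩ u [])
      (Registers.state ⟨1, p, n, m, 0, b, 0, 0, 0, 0, 0, 0, p, b, 0, data⟩ u []) 2 :=
    Runs.block (by decide) (by simp)
  have h2 := mulAdd_runs p n m 0 b 0 0 0 0 0 0 p b 0 data u []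
  have h3 : (Cmd.block [.print Reg.acc, .const Reg.acc 0, .sub Reg.k Reg.p Reg.one,
      .const Reg.x 0, .add Reg.x Reg.x Reg.m]).Runs
      (Registers.state ⟨1, p, n, m, 0, b, 0, 0, 0, 0, 0, 0 + b * p, p, 0, 0, data⟩ u [])
      (Registers.state ⟨1, p, n, m, 0, b, 0, 0, 0, 0, 0, 0, m, p - 1, 0, data⟩ u [b * p]) 5 :=
    Runs.block (by decide) (by simp)
  have h4 := mulAdd_runs p n m 0 b 0 0 0 0 0 0 m (p - 1) 0 data u [b * p]
  refine ⟨_, ?_, (h1.seq (h2.seq (h3.seq (h4.seq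
    (Runs.block (l := [.print Reg.acc]) (by decide) rfl))))).mono ?_⟩
  · simp
  · simp only [List.length_cons, List.length_nil]
    omega

/-- The whole program, in structured form. -/
def mainCmd : Cmd :=
  .seq readInput (.seq power (.seq (.block [.sub Reg.c Reg.acc Reg.one, .const Reg.acc 0,
    .add Reg.best Reg.best Reg.m]) (.seq search writeOutput)))

theorem minCount_le (p n m : ℕ) (data : ℕ → ℕ) (M k : ℕ) : minCount p n m data M k ≤ m := by
  induction k with
  | zero => exact le_rfl
  | succ k ih => exact (min_le_left _ _).trans ih

/-- Correctness and running time of the program. -/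
theorem mainCmd_outputsWithin (p n m X : ℕ) (L : List ℕ) (hp : 0 < p) (hL : L.length = m * n)
    (hLp : ∀ x ∈ L, x ≤ p) (hpX : p ≤ X) (hnX : n ≤ X) (hmX : m ≤ X) (hMX : p ^ n ≤ X) :
    OutputsWithin (mainCmd.compile 0) (p :: n :: m :: L)
      [minCount p n m (fun a => L.getD a 0) (p ^ n - 1) (p ^ n - 1) * p, (p - 1) * m]
      (1000 * X ^ 5) := by
  have hdata : stored L (m * n) = fun a => L.getD a 0 := by
    funext a
    by_cases h : a < m * n
    · simp [stored, h]
    · simp [stored, h, hL]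
  have hd : ∀ a, L.getD a 0 ≤ p := by
    intro a
    by_cases h : a < L.length
    · rw [List.getD_eq_getElem _ _ h]
      exact hLp _ (List.getElem_mem h)
    · rw [List.getD_eq_default _ _ (not_lt.1 h)]
      exact hp.le
  set M := p ^ n - 1 with hM
  set B := minCount p n m (fun a => L.getD a 0) M M with hB
  obtain ⟨s', hs', h5⟩ := writeOutput_runs p n m B (fun a => L.getD a 0) (L.drop (m * n))
  have h1 := readInput_runs p n m L []
  rw [hdata] at h1
  have h2 := power_runs p n m (m * n + 15) (fun a => L.getD a 0) (L.drop (m * n)) []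
  have h3 : (Cmd.block [.sub Reg.c Reg.acc Reg.one, .const Reg.acc 0,
      .add Reg.best Reg.best Reg.m]).Runs
      (Registers.state ⟨1, p, n, m, 0, 0, 0, 0, 0, 0, 0, p ^ n, 0, 0, 0, fun a => L.getD a 0⟩
        (L.drop (m * n)) [])
      (Registers.state ⟨1, p, n, m, M, m, 0, 0, 0, 0, 0, 0, 0, 0, 0, fun a => L.getD a 0⟩
        (L.drop (m * n)) []) 3 := Runs.block (by decide) (by simp [hM])
  have h4 := search_runs p n m M (fun a => L.getD a 0) (L.drop (m * n)) [] hp hd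
  have h := (h1.seq (h2.seq (h3.seq (h4.seq h5)))).mono (T' := 1000 * X ^ 5) ?_
  · rw [← hs']
    exact h.outputsWithin
  · have hX : 1 ≤ X := hp.trans_le hpX
    have hBX : B ≤ X := (minCount_le _ _ _ _ _ _).trans hmX
    have hMX' : M ≤ X := (Nat.sub_le _ _).trans hMX
    calc _ ≤ X * (X * 7 + 5) + 7 + (X * (4 * X + 8) + 4 + (3 +
          (X * (X * (X * (10 * X + 13) + 6 * (X * (X * X)) + 17) + 11) + 1 +
            (4 * X + 4 * X + 10)))) := by gcongr
      _ = 6 * X ^ 5 + 10 * X ^ 4 + 13 * X ^ 3 + 28 * X ^ 2 + 32 * X + 25 := by ring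
      _ ≤ 6 * X ^ 5 + 10 * X ^ 5 + 13 * X ^ 5 + 28 * X ^ 5 + 32 * X ^ 5 + 25 * X ^ 5 := by
        have h4 : X ^ 4 ≤ X ^ 5 := Nat.pow_le_pow_right hX (by norm_num)
        have h3 : X ^ 3 ≤ X ^ 5 := Nat.pow_le_pow_right hX (by norm_num)
        have h2 : X ^ 2 ≤ X ^ 5 := Nat.pow_le_pow_right hX (by norm_num)
        have h1 : X ≤ X ^ 5 := Nat.le_self_pow (by norm_num) X
        have h0 : 1 ≤ X ^ 5 := Nat.one_le_pow _ _ hX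
        omega
      _ ≤ 1000 * X ^ 5 := by omega

end RAM

/-! ### Sums over multisets -/

theorem Multiset.sum_univ_count_mul {ι R : Type*} [Fintype ι] [DecidableEq ι] [CommSemiring R]
    (S : Multiset ι) (f : ι → R) : ∑ x, (S.count x : R) * f x = (S.map f).sum := by
  induction S using Multiset.induction with
  | empty => simp
  | cons a S ih =>
    simp [Multiset.count_cons, add_mul, Finset.sum_add_distrib, ih, add_comm]

/-! ### Cayley graphs -/

section Cayley

open Matrix

variable {Γ : Type*} [AddCommGroup Γ]

theorem card_multiplesUpToHalf (p : ℕ) (S : Multiset Γ) :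
    (multiplesUpToHalf p S).card = p / 2 * S.card := by
  simp [multiplesUpToHalf, Multiset.card_bind]

variable [DecidableEq Γ]

/-- The number of elements that leave `Q` under translation by `s`. -/
def exitCount (Q : Finset Γ) (s : Γ) : ℕ := (Q.filter fun u => u + s ∉ Q).card

theorem exitCount_zero (Q : Finset Γ) : exitCount Q 0 = 0 := by
  simp [exitCount]

theorem exitCount_add_le (Q : Finset Γ) (s t : Γ) :
    exitCount Q (s + t) ≤ exitCount Q s + exitCount Q t := by
  have h : Q.filter (fun u => u + (s + t) ∉ Q) ⊆ Q.filter (fun u => u + s ∉ Q) ∪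
      (Q.filter fun u => u + t ∉ Q).image (fun u => u - s) := by
    intro u hu
    simp only [Finset.mem_filter, Finset.mem_union, Finset.mem_image] at hu ⊢
    by_cases h : u + s ∈ Q
    · exact Or.inr ⟨u + s, ⟨h, by rw [add_assoc]; exact hu.2⟩, by simp⟩
    · exact Or.inl ⟨hu.1, h⟩
  exact (Finset.card_le_card h).trans ((Finset.card_union_le _ _).trans
    (Nat.add_le_add_left Finset.card_image_le _))

theorem exitCount_nsmul_le (Q : Finset Γ) (k : ℕ) (s : Γ) :
    exitCount Q (k • s) ≤ k * exitCount Q s := by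
  induction k with
  | zero => simp [exitCount_zero]
  | succ k ih =>
    rw [succ_nsmul, Nat.succ_mul]
    exact (exitCount_add_le Q _ _).trans (Nat.add_le_add_right ih _)

variable [Fintype Γ] {S : Multiset Γ} (hS : SymmGens S)

theorem cayley_deg (u : Γ) : (cayley S hS).deg u = S.card := by
  rw [show S.card = ∑ x, S.count x by simp]
  exact Fintype.sum_equiv (Equiv.subRight u) _ _ fun v => rfl

theorem cayley_vol (Q : Finset Γ) : (cayley S hS).vol Q = Q.card * S.card := by
  simp [MultiGraph.vol, cayley_deg]

theorem cayley_cut (Q : Finset Γ) : (cayley S hS).cut Q = (S.map (exitCount Q)).sum := by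
  rw [← Multiset.sum_univ_count_mul]
  have h : ∀ u, ∑ v ∈ Qᶜ, S.count (v - u) = ∑ s, if u + s ∉ Q then S.count s else 0 := by
    intro u
    rw [← Finset.sum_filter]
    refine Finset.sum_bij' (fun v _ => v - u) (fun s _ => u + s) ?_ ?_ ?_ ?_ ?_ <;> simp
  simp only [MultiGraph.cut, cayley, h]
  rw [Finset.sum_comm]
  refine Finset.sum_congr rfl fun s _ => ?_
  rw [exitCount, Finset.card_filter, Nat.cast_id, Finset.mul_sum]
  simp

/-- Leaving `Q` under translation by `k s` requires leaving it in one of `k` translations by `s`;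
and `1 + ⋯ + p / 2 = (p / 2) (p / 2 + 1) / 2`. -/
theorem two_mul_cut_multiplesUpToHalf_le (p : ℕ) (Q : Finset Γ) :
    2 * (cayley (multiplesUpToHalf p S) (hS.multiplesUpToHalf p)).cut Q ≤
      p / 2 * (p / 2 + 1) * (cayley S hS).cut Q := by
  rw [cayley_cut, cayley_cut, multiplesUpToHalf, Multiset.map_bind, Multiset.sum_bind]
  have h : ∀ k, (Multiset.map (exitCount Q) (S.map fun s => k • s)).sum ≤
      k * (S.map (exitCount Q)).sum := by
    intro k
    rw [Multiset.map_map, ← Multiset.sum_map_mul_left]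
    exact Multiset.sum_map_le_sum_map _ _ fun s _ => exitCount_nsmul_le Q k s
  change 2 * (∑ k ∈ Finset.Icc 1 (p / 2),
    (Multiset.map (exitCount Q) (S.map fun s => k • s)).sum) ≤ _
  have h2 : (∑ k ∈ Finset.Icc 1 (p / 2), k) * 2 = p / 2 * (p / 2 + 1) := by
    induction p / 2 with
    | zero => simp
    | succ m ih =>
      rw [Finset.sum_Icc_succ_top (by omega), Nat.add_mul, ih]
      ring
  calc _ ≤ 2 * ∑ k ∈ Finset.Icc 1 (p / 2), k * (S.map (exitCount Q)).sum :=
        Nat.mul_le_mul_left _ (Finset.sum_le_sum fun k _ => h k)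
    _ = _ := by rw [← Finset.sum_mul, ← h2]; ring

theorem cayley_normLap_apply (u v : Γ) :
    (cayley S hS).normLap u v = (if u = v then 1 else 0) - (S.count (v - u) : ℝ) / S.card := by
  have h : (cayley S hS).mult u v = S.count (v - u) := rfl
  simp [MultiGraph.normLap, MultiGraph.normAdj, cayley_deg, Matrix.one_apply, h]

/-- The quadratic form of the normalized Laplacian at the indicator function of `Q`. -/
theorem cayley_normLap_indicator (h0 : S.card ≠ 0) (Q : Finset Γ) :
    (fun u => if u ∈ Q then (1 : ℝ) else 0) ⬝ᵥ
      ((cayley S hS).normLap *ᵥ fun u => if u ∈ Q then (1 : ℝ) else 0) =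
      (cayley S hS).cut Q / S.card := by
  have h0' : (S.card : ℝ) ≠ 0 := by exact_mod_cast h0
  have hdeg : ∀ u, ∑ v ∈ Q, (S.count (v - u) : ℝ) = S.card - ∑ v ∈ Qᶜ, (S.count (v - u) : ℝ) := by
    intro u
    have := cayley_deg hS u
    rw [eq_sub_iff_add_eq, Finset.sum_add_sum_compl]
    exact_mod_cast this
  have h1 : ∀ u ∈ Q, ∑ v ∈ Q, (cayley S hS).normLap u v =
      (∑ v ∈ Qᶜ, (S.count (v - u) : ℝ)) / S.card := by
    intro u hu
    simp only [cayley_normLap_apply, Finset.sum_sub_distrib, Finset.sum_ite_eq, hu, if_true,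
      ← Finset.sum_div, hdeg]
    field_simp
    ring
  have h2 : (((cayley S hS).cut Q : ℕ) : ℝ) = ∑ u ∈ Q, ∑ v ∈ Qᶜ, (S.count (v - u) : ℝ) := by
    simp [MultiGraph.cut, cayley]
  rw [h2, Finset.sum_div, ← Finset.sum_congr rfl h1]
  simp [dotProduct, mulVec, Finset.sum_ite_mem]

end Cayley

/-! ### The second smallest eigenvalue of a graph with known spectrum -/

/-- If the `μ a` are the eigenvalues of the normalized Laplacian with multiplicity, `μ a₀` is the
smallest of them, and `μ a₁` is the smallest of the others, then `λ₂ = μ a₁`. -/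
theorem MultiGraph.lambda_two_eq {V : Type*} [Fintype V] [DecidableEq V] (G : MultiGraph V)
    (μ : V → ℝ) (hμ : G.normLap.charpoly = ∏ a, (Polynomial.X - Polynomial.C (μ a)))
    (a₀ a₁ : V) (h01 : a₁ ≠ a₀) (h0 : μ a₀ ≤ μ a₁) (h1 : ∀ a ≠ a₀, μ a₁ ≤ μ a) :
    G.lambda 2 = μ a₁ := by
  have hcard : 2 ≤ Fintype.card V := Fintype.one_lt_card_iff.2 ⟨_, _, h01⟩
  have hroots : Finset.univ.val.map G.normLap_isHermitian.eigenvalues₀ =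
      Finset.univ.val.map μ := by
    have h := G.normLap_isHermitian.roots_charpoly_eq_eigenvalues₀
    have h' : ∏ a, (Polynomial.X - Polynomial.C (μ a)) =
        ((Finset.univ.val.map μ).map fun x => Polynomial.X - Polynomial.C x).prod := by
      rw [Multiset.map_map]
      rfl
    rw [hμ, h', Polynomial.roots_multiset_prod_X_sub_C] at h
    exact h.symm
  have hcount : ∀ P : ℝ → Prop, ∀ _ : DecidablePred P,
      (Finset.univ.filter fun i => P (G.normLap_isHermitian.eigenvalues₀ i)).card =
      (Finset.univ.filter fun a => P (μ a)).card := by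
    intro P _
    have h := congrArg (Multiset.countP P) hroots
    rw [Multiset.countP_map, Multiset.countP_map] at h
    exact h
  have hanti := G.normLap_isHermitian.eigenvalues₀_antitone
  rw [MultiGraph.lambda, dif_pos ⟨by norm_num, hcard⟩]
  set i₂ : Fin (Fintype.card V) := ⟨Fintype.card V - 2, by omega⟩ with hi₂
  set i₁ : Fin (Fintype.card V) := ⟨Fintype.card V - 1, by omega⟩ with hi₁
  have h12 : i₂ ≤ i₁ := by simp only [hi₁, hi₂, Fin.mk_le_mk]; omega
  have hne : i₂ ≠ i₁ := by simp only [hi₁, hi₂, ne_eq, Fin.mk.injEq]; omega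
  refine le_antisymm (not_lt.1 fun hlt => ?_) (not_lt.1 fun hlt => ?_)
  · -- Only the last index can carry an eigenvalue `≤ μ a₁`, but `a₀` and `a₁` do.
    have h := hcount (fun x => x ≤ μ a₁) (Classical.decPred _)
    have hle : (Finset.univ.filter fun i =>
        G.normLap_isHermitian.eigenvalues₀ i ≤ μ a₁).card ≤ ({i₁} : Finset _).card := by
      refine Finset.card_le_card fun i hi => ?_
      rw [Finset.mem_filter] at hi
      rw [Finset.mem_singleton]
      by_contra hi'
      have : i ≤ i₂ := by
        have : (i : ℕ) ≠ Fintype.card V - 1 := fun h => hi' (Fin.ext h)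
        have := i.2
        rw [Fin.le_def]
        simp only [hi₂]
        omega
      exact absurd (hanti this) (not_le.2 (hi.2.trans_lt hlt))
    have hge : ({a₀, a₁} : Finset V).card ≤
        (Finset.univ.filter fun a => μ a ≤ μ a₁).card := by
      refine Finset.card_le_card fun a ha => ?_
      rw [Finset.mem_insert, Finset.mem_singleton] at ha
      rcases ha with rfl | rfl <;> simp [h0]
    rw [Finset.card_pair h01.symm] at hge
    rw [Finset.card_singleton] at hle
    have : (2 : ℕ) ≤ 1 := hge.trans ((le_of_eq (by convert h.symm)).trans hle)
    omega
  · -- The last two indices carry eigenvalues `< μ a₁`, but only `a₀` can do so.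
    have h := hcount (fun x => x < μ a₁) (Classical.decPred _)
    have hle : (Finset.univ.filter fun a => μ a < μ a₁).card ≤ ({a₀} : Finset V).card := by
      refine Finset.card_le_card fun a ha => ?_
      rw [Finset.mem_filter] at ha
      rw [Finset.mem_singleton]
      by_contra ha'
      exact absurd (h1 a ha') (not_le.2 ha.2)
    have hge : ({i₂, i₁} : Finset _).card ≤ (Finset.univ.filter fun i =>
        G.normLap_isHermitian.eigenvalues₀ i < μ a₁).card := by
      refine Finset.card_le_card fun i hi => ?_
      rw [Finset.mem_insert, Finset.mem_singleton] at hi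
      rcases hi with rfl | rfl
      · simpa using hlt
      · simpa using (hanti h12).trans_lt hlt
    rw [Finset.card_pair hne] at hge
    rw [Finset.card_singleton] at hle
    have : (2 : ℕ) ≤ 1 := hge.trans ((le_of_eq (by convert h)).trans hle)
    omega

/-! ### Characters of `ℤ_p^n` -/

section Fourier

open Matrix

variable {p n : ℕ} [Fact p.Prime]

theorem sum_stdAddChar_dotProduct (α : Fin n → ZMod p) :
    ∑ x, ZMod.stdAddChar (α ⬝ᵥ x) = if α = 0 then (p : ℂ) ^ n else 0 := by
  let φ : (Fin n → ZMod p) →+ ZMod p :=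
    { toFun := fun x => α ⬝ᵥ x, map_zero' := dotProduct_zero α, map_add' := dotProduct_add α }
  let ψ := (ZMod.stdAddChar (N := p)).compAddMonoidHom φ
  have h : ψ = 0 ↔ α = 0 := by
    constructor
    · intro h
      ext i
      have h1 : ZMod.stdAddChar (α i) = 1 := by
        have := DFunLike.congr_fun h (Pi.single i 1)
        simpa [ψ, φ] using this
      have := ZMod.injective_stdAddChar (h1.trans (AddChar.map_zero_eq_one _).symm)
      simpa using this
    · rintro rfl
      ext x
      simp [ψ, φ]
  classical
  have := AddChar.sum_eq_ite ψ
  simp only [h] at this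
  simpa [ψ, φ] using this

/-- The character table of `ℤ_p^n`: the columns are the characters `x ↦ e(⟨α, x⟩)`. -/
noncomputable def fourierMatrix (p n : ℕ) [Fact p.Prime] :
    Matrix (Fin n → ZMod p) (Fin n → ZMod p) ℂ :=
  Matrix.of fun x α => ZMod.stdAddChar (α ⬝ᵥ x)

theorem fourierMatrix_mul_conjTranspose :
    fourierMatrix p n * (fourierMatrix p n)ᴴ = (p : ℂ) ^ n • 1 := by
  ext x y
  have h : ∀ α : Fin n → ZMod p, ZMod.stdAddChar (α ⬝ᵥ x) * star (ZMod.stdAddChar (α ⬝ᵥ y)) =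
      ZMod.stdAddChar ((x - y) ⬝ᵥ α) := by
    intro α
    rw [Complex.star_def, ← AddChar.map_neg_eq_conj, ← AddChar.map_add_eq_mul,
      dotProduct_comm (x - y), dotProduct_sub, sub_eq_add_neg]
  simp only [mul_apply, fourierMatrix, conjTranspose_apply, of_apply, h,
    sum_stdAddChar_dotProduct, Matrix.smul_apply, one_apply, sub_eq_zero, smul_eq_mul, mul_ite,
    mul_one, mul_zero]

theorem conjTranspose_mul_fourierMatrix :
    (fourierMatrix p n)ᴴ * fourierMatrix p n = (p : ℂ) ^ n • 1 := by
  have hN : (p : ℂ) ^ n ≠ 0 := pow_ne_zero _ (by exact_mod_cast (Fact.out : p.Prime).ne_zero)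
  have h : fourierMatrix p n * (((p : ℂ) ^ n)⁻¹ • (fourierMatrix p n)ᴴ) = 1 := by
    rw [mul_smul_comm, fourierMatrix_mul_conjTranspose, smul_smul, inv_mul_cancel₀ hN, one_smul]
  have h2 := mul_eq_one_comm.1 h
  rw [smul_mul_assoc] at h2
  rw [← h2, smul_smul, mul_inv_cancel₀ hN, one_smul]

variable {S : Multiset (Fin n → ZMod p)} (hS : SymmGens S) {μ : (Fin n → ZMod p) → ℝ}

/-- The characters diagonalize the normalized Laplacian of a Cayley graph. -/
theorem normLap_mul_fourierMatrix (h0 : S.card ≠ 0)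
    (hμ : ∀ α, (S.map fun s => ZMod.stdAddChar (α ⬝ᵥ s)).sum = S.card * (1 - μ α : ℂ)) :
    (cayley S hS).normLap.map Complex.ofRealHom * fourierMatrix p n =
      fourierMatrix p n * diagonal fun α => (μ α : ℂ) := by
  have h0' : (S.card : ℂ) ≠ 0 := by exact_mod_cast h0
  ext u α
  rw [mul_diagonal, mul_apply]
  have h1 : ∑ v, (S.count (v - u) : ℂ) * ZMod.stdAddChar (α ⬝ᵥ v) =
      ZMod.stdAddChar (α ⬝ᵥ u) * (S.card * (1 - μ α : ℂ)) := by
    rw [← hμ, ← Multiset.sum_univ_count_mul, Finset.mul_sum]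
    refine Fintype.sum_equiv (Equiv.subRight u) _ _ fun v => ?_
    rw [Equiv.subRight_apply, mul_left_comm, ← AddChar.map_add_eq_mul, ← dotProduct_add,
      add_sub_cancel]
  have h2 : ∀ v, (cayley S hS).normLap.map Complex.ofRealHom u v * fourierMatrix p n v α =
      (if u = v then ZMod.stdAddChar (α ⬝ᵥ v) else 0) -
        (S.count (v - u) : ℂ) * ZMod.stdAddChar (α ⬝ᵥ v) / S.card := by
    intro v
    rw [map_apply, cayley_normLap_apply]
    simp only [fourierMatrix, of_apply]
    split_ifs <;> push_cast [Complex.ofRealHom_eq_coe] <;> ring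
  rw [Finset.sum_congr rfl fun v _ => h2 v]
  simp only [Finset.sum_sub_distrib, Finset.sum_ite_eq, Finset.mem_univ, if_true,
    ← Finset.sum_div, h1, fourierMatrix, of_apply]
  field_simp
  ring

/-- The spectral decomposition of the normalized Laplacian, with the factor `p ^ n` cleared. -/
theorem normLap_map_eq (h0 : S.card ≠ 0)
    (hμ : ∀ α, (S.map fun s => ZMod.stdAddChar (α ⬝ᵥ s)).sum = S.card * (1 - μ α : ℂ)) :
    (p : ℂ) ^ n • (cayley S hS).normLap.map Complex.ofRealHom =
      fourierMatrix p n * (diagonal fun α => (μ α : ℂ)) * (fourierMatrix p n)ᴴ := by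
  rw [← normLap_mul_fourierMatrix hS h0 hμ, Matrix.mul_assoc, fourierMatrix_mul_conjTranspose,
    mul_smul_comm, Matrix.mul_one]

theorem cayley_charpoly (h0 : S.card ≠ 0)
    (hμ : ∀ α, (S.map fun s => ZMod.stdAddChar (α ⬝ᵥ s)).sum = S.card * (1 - μ α : ℂ)) :
    (cayley S hS).normLap.charpoly = ∏ α, (Polynomial.X - Polynomial.C (μ α)) := by
  have hN : (p : ℂ) ^ n ≠ 0 := pow_ne_zero _ (by exact_mod_cast (Fact.out : p.Prime).ne_zero)
  apply Polynomial.map_injective Complex.ofRealHom Complex.ofRealHom.injective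
  have h : (cayley S hS).normLap.map Complex.ofRealHom =
      (fourierMatrix p n * (diagonal fun α => (μ α : ℂ))) *
        (((p : ℂ) ^ n)⁻¹ • (fourierMatrix p n)ᴴ) := by
    rw [mul_smul_comm, ← normLap_map_eq hS h0 hμ, smul_smul, inv_mul_cancel₀ hN, one_smul]
  rw [← charpoly_map, h, charpoly_mul_comm, ← Matrix.mul_assoc, smul_mul_assoc,
    conjTranspose_mul_fourierMatrix, smul_smul, inv_mul_cancel₀ hN, one_smul, Matrix.one_mul,
    charpoly_diagonal, Polynomial.map_prod]
  simp

/-- The variational lower bound for the quadratic form of the normalized Laplacian: a lower bound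
`W` for the eigenvalues at nontrivial characters bounds the form from below by `W` times the
squared length of the component orthogonal to the constants. -/
theorem le_normLap_quadraticForm (h0 : S.card ≠ 0)
    (hμ : ∀ α, (S.map fun s => ZMod.stdAddChar (α ⬝ᵥ s)).sum = S.card * (1 - μ α : ℂ))
    (hμ0 : μ 0 = 0) {W : ℝ} (hW : ∀ α ≠ 0, W ≤ μ α) (f : (Fin n → ZMod p) → ℝ) :
    W * ((p : ℝ) ^ n * ∑ x, f x ^ 2 - (∑ x, f x) ^ 2) ≤
      (p : ℝ) ^ n * (f ⬝ᵥ ((cayley S hS).normLap *ᵥ f)) := by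
  set F := fourierMatrix p n with hF
  set fc : (Fin n → ZMod p) → ℂ := fun x => (f x : ℂ) with hfc
  set g := Fᴴ *ᵥ fc with hg
  have hstar : star fc = fc := by
    ext x
    simp [hfc]
  have hgstar : fc ᵥ* F = star g := by
    rw [hg, star_mulVec, conjTranspose_conjTranspose, hstar]
  have hquad : ((p : ℂ) ^ n) * (fc ⬝ᵥ ((cayley S hS).normLap.map Complex.ofRealHom *ᵥ fc)) =
      ∑ α, (μ α : ℂ) * (Complex.normSq (g α) : ℂ) := by
    rw [← smul_eq_mul, ← dotProduct_smul, ← smul_mulVec, normLap_map_eq hS h0 hμ, ← mulVec_mulVec,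
      ← mulVec_mulVec, dotProduct_mulVec, hgstar, dotProduct]
    refine Finset.sum_congr rfl fun α _ => ?_
    rw [mulVec_diagonal, Complex.normSq_eq_conj_mul_self, Pi.star_apply, Complex.star_def]
    ring
  have hnorm : ((p : ℂ) ^ n) * (fc ⬝ᵥ fc) = ∑ α, (Complex.normSq (g α) : ℂ) := by
    have h1 : star g ⬝ᵥ g = ((p : ℂ) ^ n) * (fc ⬝ᵥ fc) := by
      rw [← hgstar, hg, ← dotProduct_mulVec, mulVec_mulVec, hF, fourierMatrix_mul_conjTranspose,
        smul_mulVec, one_mulVec, dotProduct_smul, smul_eq_mul]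
    rw [← h1, dotProduct]
    refine Finset.sum_congr rfl fun α _ => ?_
    rw [Complex.normSq_eq_conj_mul_self, Pi.star_apply, Complex.star_def]
  have hquadR : (p : ℝ) ^ n * (f ⬝ᵥ ((cayley S hS).normLap *ᵥ f)) =
      ∑ α, μ α * Complex.normSq (g α) := by
    apply Complex.ofReal_injective
    push_cast
    rw [← hquad]
    simp [dotProduct, mulVec, hfc]
  have hnormR : (p : ℝ) ^ n * ∑ x, f x ^ 2 = ∑ α, Complex.normSq (g α) := by
    apply Complex.ofReal_injective
    push_cast
    rw [← hnorm]
    simp [dotProduct, hfc, sq]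
  have hg0 : Complex.normSq (g 0) = (∑ x, f x) ^ 2 := by
    have : g 0 = ((∑ x, f x : ℝ) : ℂ) := by
      simp [hg, hF, mulVec, dotProduct, fourierMatrix, hfc]
    rw [this, Complex.normSq_ofReal, sq]
  rw [hquadR, hnormR, ← hg0, ← Finset.add_sum_erase _ _ (Finset.mem_univ 0), add_sub_cancel_left,
    ← Finset.add_sum_erase _ (fun α => μ α * Complex.normSq (g α)) (Finset.mem_univ 0), hμ0,
    zero_mul, zero_add, Finset.mul_sum]
  exact Finset.sum_le_sum fun α hα =>
    mul_le_mul_of_nonneg_right (hW α (Finset.ne_of_mem_erase hα)) (Complex.normSq_nonneg _)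

/-- The easy direction of Cheeger's inequality, with `2 |Q| ≤ |ℤ_p^n|`. -/
theorem mul_card_le_two_mul_cut (h0 : S.card ≠ 0)
    (hμ : ∀ α, (S.map fun s => ZMod.stdAddChar (α ⬝ᵥ s)).sum = S.card * (1 - μ α : ℂ))
    (hμ0 : μ 0 = 0) {W : ℝ} (hW0 : 0 ≤ W) (hW : ∀ α ≠ 0, W ≤ μ α)
    (Q : Finset (Fin n → ZMod p)) (hQ : 2 * Q.card ≤ p ^ n) :
    W * (Q.card * S.card) ≤ 2 * (cayley S hS).cut Q := by
  have hN : (0 : ℝ) < (p : ℝ) ^ n := pow_pos (by exact_mod_cast (Fact.out : p.Prime).pos) _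
  have hc : (0 : ℝ) < S.card := by exact_mod_cast Nat.pos_of_ne_zero h0
  have h := le_normLap_quadraticForm hS h0 hμ hμ0 hW (fun u => if u ∈ Q then (1 : ℝ) else 0)
  rw [cayley_normLap_indicator hS h0] at h
  simp only [ite_pow, one_pow, ne_eq, OfNat.ofNat_ne_zero, not_false_eq_true, zero_pow,
    Finset.sum_ite_mem, Finset.univ_inter, Finset.sum_const, nsmul_eq_mul, mul_one] at h
  have hQ' : 2 * (Q.card : ℝ) ≤ (p : ℝ) ^ n := by exact_mod_cast hQ
  have h1 : W * ((p : ℝ) ^ n * Q.card / 2) ≤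
      (p : ℝ) ^ n * (((cayley S hS).cut Q : ℝ) / S.card) := by
    refine le_trans (mul_le_mul_of_nonneg_left ?_ hW0) h
    nlinarith [(Q.card.cast_nonneg : (0 : ℝ) ≤ Q.card)]
  have h2 : (p : ℝ) ^ n * (W * Q.card / 2) ≤
      (p : ℝ) ^ n * (((cayley S hS).cut Q : ℝ) / S.card) := by linarith
  have h3 := le_of_mul_le_mul_left h2 hN
  rw [le_div_iff₀ hc] at h3
  linarith

end Fourier

/-! ### The spectrum of the enlarged Cayley graph -/

/-- The symmetric geometric sum `∑_{|k| ≤ m} z ^ k`, multiplied by `z - 1`, telescopes. -/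
theorem sum_Icc_pow_add_inv_pow_mul {K : Type*} [Field K] {z : K} (hz : z ≠ 0) (m : ℕ) :
    (1 + ∑ k ∈ Finset.Icc 1 m, (z ^ k + z⁻¹ ^ k)) * (z - 1) = z ^ (m + 1) - z⁻¹ ^ m := by
  induction m with
  | zero => simp
  | succ m ih =>
    rw [Finset.sum_Icc_succ_top (by omega), ← add_assoc, add_mul, ih, pow_succ z⁻¹ m]
    field_simp
    ring

section Enlarged

open Matrix

variable {p : ℕ} [Fact p.Prime]

/-- Summing a character of `ℤ_p` over the multiples `± k t`, `1 ≤ k ≤ p / 2`, gives the multiple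
`2 (p / 2) / (p - 1)` (which is `1` for odd `p` and `2` for `p = 2`) of the sum over all multiples
`a t` with `0 ≠ a ∈ ℤ_p`. -/
theorem sum_stdAddChar_multiples (t : ZMod p) :
    ((p : ℂ) - 1) * ∑ k ∈ Finset.Icc 1 (p / 2),
      (ZMod.stdAddChar (k • t) + ZMod.stdAddChar (-(k • t))) =
      2 * ((p / 2 : ℕ) : ℂ) * ((if t = 0 then (p : ℂ) else 0) - 1) := by
  have hp : p.Prime := Fact.out
  by_cases ht : t = 0
  · simp [ht]
    ring
  set z : ℂ := ZMod.stdAddChar t with hzdef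
  have hz1 : z ≠ 1 := fun h =>
    ht (ZMod.injective_stdAddChar (h.trans (AddChar.map_zero_eq_one _).symm))
  have hzp : z ^ p = 1 := by
    rw [hzdef, ← AddChar.map_nsmul_eq_pow]
    simp
  have hz0 : z ≠ 0 := by
    intro h
    rw [h, zero_pow hp.ne_zero] at hzp
    exact zero_ne_one hzp
  have hterm : ∀ k : ℕ, ZMod.stdAddChar (k • t) + ZMod.stdAddChar (-(k • t)) =
      z ^ k + z⁻¹ ^ k := by
    intro k
    rw [AddChar.map_neg_eq_inv, AddChar.map_nsmul_eq_pow, inv_pow]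
  simp only [hterm, if_neg ht]
  have hsum := sum_Icc_pow_add_inv_pow_mul hz0 (p / 2)
  rcases hp.eq_two_or_odd with rfl | hodd
  · -- For `p = 2` the only nonzero multiple is counted twice.
    have hzm : z = -1 := by
      have h : (z - 1) * (z + 1) = 0 := by linear_combination hzp
      exact eq_neg_of_add_eq_zero_left ((mul_eq_zero.1 h).resolve_left (sub_ne_zero.2 hz1))
    simp [hzm]
    norm_num
  · have h1 : z ^ (p / 2 + 1) - z⁻¹ ^ (p / 2) = 0 := by
      have : z ^ (p / 2 + 1) * z ^ (p / 2) = 1 := by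
        rw [← pow_add, show p / 2 + 1 + p / 2 = p by omega, hzp]
      rw [inv_pow, sub_eq_zero]
      exact eq_inv_of_mul_eq_one_left this
    rw [h1] at hsum
    have h2 := (mul_eq_zero.1 hsum).resolve_right (sub_ne_zero.2 hz1)
    have h3 : (p : ℂ) = 2 * ((p / 2 : ℕ) : ℂ) + 1 := by
      have : p = 2 * (p / 2) + 1 := by omega
      exact_mod_cast this
    rw [show ∑ k ∈ Finset.Icc 1 (p / 2), (z ^ k + z⁻¹ ^ k) = -1 by linear_combination h2, h3]
    ring

variable {n : ℕ} {S : Multiset (Fin n → ZMod p)}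

/-- The eigenvalue of the normalized Laplacian of the enlarged Cayley graph at the character `α` is
`p / (p - 1)` times the proportion of generators outside the hyperplane orthogonal to `α`. -/
theorem sum_map_stdAddChar_multiplesUpToHalf (hS : SymmGens S) (h0 : S.card ≠ 0)
    (α : Fin n → ZMod p) :
    ((multiplesUpToHalf p S).map fun s => ZMod.stdAddChar (α ⬝ᵥ s)).sum =
      (multiplesUpToHalf p S).card *
        (1 - ((p * S.countP (fun s => α ⬝ᵥ s ≠ 0) / ((p - 1) * S.card) : ℝ) : ℂ)) := by
  have hp : p.Prime := Fact.out
  have hp1 : (p : ℂ) - 1 ≠ 0 := sub_ne_zero.2 (by exact_mod_cast hp.one_lt.ne')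
  have h0' : (S.card : ℂ) ≠ 0 := by exact_mod_cast h0
  set A := ((multiplesUpToHalf p S).map fun s => ZMod.stdAddChar (α ⬝ᵥ s)).sum with hA
  -- As the generators are symmetric, each `e(⟨α, s⟩)` may be replaced by the mean of its values at
  -- `s` and `-s`; for odd `p` the multiples `± k s` then run through all nonzero multiples of `s`.
  have hneg : A = ((multiplesUpToHalf p S).map fun s => ZMod.stdAddChar (-(α ⬝ᵥ s))).sum := by
    rw [hA]
    conv_lhs => rw [← (symmGens_iff_map_neg _).1 (hS.multiplesUpToHalf p)]
    simp [Multiset.map_map]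
  have hsum : ∀ g : ZMod p → ℂ, ((multiplesUpToHalf p S).map fun s => g (α ⬝ᵥ s)).sum =
      (S.map fun s => ∑ k ∈ Finset.Icc 1 (p / 2), g (k • (α ⬝ᵥ s))).sum := by
    intro g
    rw [multiplesUpToHalf, Multiset.map_bind, Multiset.sum_bind]
    simp only [Multiset.map_map, Function.comp_def, dotProduct_smul]
    rw [Multiset.sum_map_sum_map]
    rfl
  have h2 : ((p : ℂ) - 1) * (2 * A) =
      2 * ((p / 2 : ℕ) : ℂ) * (S.map fun s => (if α ⬝ᵥ s = 0 then (p : ℂ) else 0) - 1).sum := by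
    rw [two_mul]
    nth_rewrite 2 [hneg]
    rw [hA, hsum, hsum (fun t => ZMod.stdAddChar (-t)), ← Multiset.sum_map_add,
      ← Multiset.sum_map_mul_left, ← Multiset.sum_map_mul_left]
    congr 1
    refine Multiset.map_congr rfl fun s _ => ?_
    rw [← Finset.sum_add_distrib, sum_stdAddChar_multiples]
  have h3 : (S.map fun s => (if α ⬝ᵥ s = 0 then (p : ℂ) else 0) - 1).sum =
      p * (S.card - S.countP (fun s => α ⬝ᵥ s ≠ 0)) - S.card := by
    clear hA hneg hsum h2 h0 h0' hS A
    induction S using Multiset.induction with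
    | empty => simp
    | cons a S ih =>
      rw [Multiset.map_cons, Multiset.sum_cons, ih, Multiset.countP_cons, Multiset.card_cons]
      by_cases h : α ⬝ᵥ a = 0 <;> simp [h] <;> ring
  rw [h3] at h2
  rw [card_multiplesUpToHalf]
  push_cast
  field_simp
  linear_combination h2 / 2

end Enlarged

/-! ### Conductance of the Cayley graph -/

section Conductance

open Matrix

variable {p n : ℕ} [Fact p.Prime] {S : Multiset (Fin n → ZMod p)}

/-- The hyperplane orthogonal to `α`. -/
def hyperplane (α : Fin n → ZMod p) : Finset (Fin n → ZMod p) :=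
  Finset.univ.filter fun x => α ⬝ᵥ x = 0

theorem card_hyperplane_pos (α : Fin n → ZMod p) : 0 < (hyperplane α).card :=
  Finset.card_pos.2 ⟨0, by simp [hyperplane]⟩

theorem card_space : (Finset.univ : Finset (Fin n → ZMod p)).card = p ^ n := by
  simp [ZMod.card]

theorem two_mul_card_hyperplane_le {α : Fin n → ZMod p} (hα : α ≠ 0) :
    2 * (hyperplane α).card ≤ p ^ n := by
  obtain ⟨i, hi⟩ := Function.ne_iff.1 hα
  have hi : α i ≠ 0 := hi
  let v : Fin n → ZMod p := Pi.single i 1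
  have hdisj : Disjoint (hyperplane α) ((hyperplane α).map (Equiv.addRight v).toEmbedding) := by
    rw [Finset.disjoint_left]
    intro x hx hx'
    simp only [hyperplane, Finset.mem_filter, Finset.mem_map, Finset.mem_univ, true_and,
      Equiv.coe_toEmbedding, Equiv.coe_addRight] at hx hx'
    obtain ⟨y, hy, rfl⟩ := hx'
    rw [dotProduct_add, hy, zero_add] at hx
    simp [v, hi] at hx
  have h := Finset.card_le_univ (hyperplane α ∪ (hyperplane α).map (Equiv.addRight v).toEmbedding)
  rw [Finset.card_union_of_disjoint hdisj, Finset.card_map, ← Finset.card_univ, card_space] at h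
  omega

/-- A generator moves the hyperplane orthogonal to `α` to itself or off itself, so the conductance
of the hyperplane is the proportion of generators that are not orthogonal to `α`. -/
theorem cut_hyperplane (hS : SymmGens S) (α : Fin n → ZMod p) :
    (cayley S hS).cut (hyperplane α) =
      (hyperplane α).card * S.countP (fun s => α ⬝ᵥ s ≠ 0) := by
  have h : ∀ s, exitCount (hyperplane α) s =
      (hyperplane α).card * if α ⬝ᵥ s ≠ 0 then 1 else 0 := by
    intro s
    have hmem : ∀ u ∈ hyperplane α, (u + s ∉ hyperplane α ↔ α ⬝ᵥ s ≠ 0) := by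
      intro u hu
      simp only [hyperplane, Finset.mem_filter, Finset.mem_univ, true_and] at hu ⊢
      rw [dotProduct_add, hu, zero_add]
    rw [exitCount, Finset.filter_congr hmem]
    split_ifs with hs <;> simp [hs]
  rw [cayley_cut, Multiset.map_congr rfl fun s _ => h s, Multiset.sum_map_mul_left]
  congr 1
  clear h hS
  induction S using Multiset.induction with
  | empty => simp
  | cons a S ih => rw [Multiset.map_cons, Multiset.sum_cons, ih, Multiset.countP_cons, add_comm]

theorem hyperplane_admissible (hS : SymmGens S) (h0 : S.card ≠ 0) {α : Fin n → ZMod p}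
    (hα : α ≠ 0) : 0 < (cayley S hS).vol (hyperplane α) ∧
      2 * (cayley S hS).vol (hyperplane α) ≤ (cayley S hS).vol Finset.univ := by
  rw [cayley_vol, cayley_vol, card_space, ← mul_assoc]
  exact ⟨Nat.mul_pos (card_hyperplane_pos α) (Nat.pos_of_ne_zero h0),
    Nat.mul_le_mul_right _ (two_mul_card_hyperplane_le hα)⟩

theorem conductance_le (hS : SymmGens S) (h0 : S.card ≠ 0) {α : Fin n → ZMod p} (hα : α ≠ 0) :
    (cayley S hS).conductance ≤ S.countP (fun s => α ⬝ᵥ s ≠ 0) / S.card := by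
  have hc : ((hyperplane α).card : ℝ) ≠ 0 := by exact_mod_cast (card_hyperplane_pos α).ne'
  have hle : (cayley S hS).conductance ≤ (cayley S hS).setConductance (hyperplane α) := by
    refine csInf_le ⟨0, ?_⟩
      ⟨_, (hyperplane_admissible hS h0 hα).1, (hyperplane_admissible hS h0 hα).2, rfl⟩
    rintro x ⟨Q, -, -, rfl⟩
    exact div_nonneg (Nat.cast_nonneg _) (Nat.cast_nonneg _)
  refine hle.trans (le_of_eq ?_)
  rw [MultiGraph.setConductance, cut_hyperplane, cayley_vol]
  push_cast
  exact mul_div_mul_left _ _ hc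

/-- The eigenvalue of the normalized Laplacian of the enlarged graph at the character `α`. -/
noncomputable def enlargedEigenvalue (S : Multiset (Fin n → ZMod p)) (α : Fin n → ZMod p) : ℝ :=
  p * S.countP (fun s => α ⬝ᵥ s ≠ 0) / ((p - 1) * S.card)

theorem enlargedEigenvalue_zero : enlargedEigenvalue S 0 = 0 := by
  simp [enlargedEigenvalue]

theorem natCast_prime_sub_one_pos : (0 : ℝ) < (p : ℝ) - 1 :=
  sub_pos.2 (by exact_mod_cast (Fact.out : p.Prime).one_lt)

theorem enlargedEigenvalue_nonneg (α : Fin n → ZMod p) : 0 ≤ enlargedEigenvalue S α := by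
  have := natCast_prime_sub_one_pos (p := p)
  unfold enlargedEigenvalue
  positivity

variable {α₁ : Fin n → ZMod p}

theorem enlargedEigenvalue_mono {α β : Fin n → ZMod p}
    (h : S.countP (fun s => α ⬝ᵥ s ≠ 0) ≤ S.countP (fun s => β ⬝ᵥ s ≠ 0)) :
    enlargedEigenvalue S α ≤ enlargedEigenvalue S β := by
  have := natCast_prime_sub_one_pos (p := p)
  unfold enlargedEigenvalue
  gcongr

theorem card_multiplesUpToHalf_ne_zero (h0 : S.card ≠ 0) :
    (multiplesUpToHalf p S).card ≠ 0 := by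
  rw [card_multiplesUpToHalf]
  have := (Fact.out : p.Prime).two_le
  exact Nat.mul_ne_zero (by omega) h0

/-- The second eigenvalue of the enlarged graph is determined by the minimal number of generators
outside a hyperplane. -/
theorem enlarged_lambda_two (hS : SymmGens S) (h0 : S.card ≠ 0) (hα₁ : α₁ ≠ 0)
    (hmin : ∀ α ≠ 0, S.countP (fun s => α₁ ⬝ᵥ s ≠ 0) ≤ S.countP (fun s => α ⬝ᵥ s ≠ 0)) :
    (cayley (multiplesUpToHalf p S) (hS.multiplesUpToHalf p)).lambda 2 =
      enlargedEigenvalue S α₁ :=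
  MultiGraph.lambda_two_eq _ (enlargedEigenvalue S)
    (cayley_charpoly _ (card_multiplesUpToHalf_ne_zero h0)
      (sum_map_stdAddChar_multiplesUpToHalf hS h0)) 0 α₁ hα₁
    (by rw [enlargedEigenvalue_zero]; exact enlargedEigenvalue_nonneg _)
    fun α hα => enlargedEigenvalue_mono (hmin α hα)

theorem conductance_le_enlargedEigenvalue (hS : SymmGens S) (h0 : S.card ≠ 0) (hα₁ : α₁ ≠ 0) :
    (cayley S hS).conductance ≤ enlargedEigenvalue S α₁ := by
  refine (conductance_le hS h0 hα₁).trans ?_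
  have h1 := natCast_prime_sub_one_pos (p := p)
  have h2 : (0 : ℝ) < S.card := by exact_mod_cast Nat.pos_of_ne_zero h0
  rw [enlargedEigenvalue, div_le_div_iff₀ h2 (mul_pos h1 h2)]
  have h3 : (0 : ℝ) ≤ S.countP (fun s => α₁ ⬝ᵥ s ≠ 0) * S.card := by positivity
  nlinarith

/-- Cheeger's inequality for the enlarged graph, combined with the comparison of cuts. -/
theorem enlargedEigenvalue_le (hS : SymmGens S) (h0 : S.card ≠ 0) (hα₁ : α₁ ≠ 0)
    (hmin : ∀ α ≠ 0, S.countP (fun s => α₁ ⬝ᵥ s ≠ 0) ≤ S.countP (fun s => α ⬝ᵥ s ≠ 0)) :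
    enlargedEigenvalue S α₁ ≤ (((p / 2 : ℕ) : ℝ) + 1) * (cayley S hS).conductance := by
  have hm : (0 : ℝ) < ((p / 2 : ℕ) : ℝ) := by
    have := (Fact.out : p.Prime).two_le
    exact_mod_cast (by omega : 0 < p / 2)
  rw [← div_le_iff₀' (by positivity)]
  refine le_csInf ⟨_, _, (hyperplane_admissible hS h0 hα₁).1,
    (hyperplane_admissible hS h0 hα₁).2, rfl⟩ ?_
  rintro x ⟨Q, hQ, hQ2, rfl⟩
  rw [cayley_vol] at hQ
  rw [cayley_vol, cayley_vol, card_space, ← mul_assoc] at hQ2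
  have hQ3 : 2 * Q.card ≤ p ^ n := Nat.le_of_mul_le_mul_right hQ2 (Nat.pos_of_ne_zero h0)
  have h1 := mul_card_le_two_mul_cut (hS.multiplesUpToHalf p) (card_multiplesUpToHalf_ne_zero h0)
    (μ := enlargedEigenvalue S) (sum_map_stdAddChar_multiplesUpToHalf hS h0)
    enlargedEigenvalue_zero (enlargedEigenvalue_nonneg α₁)
    (fun α hα => enlargedEigenvalue_mono (hmin α hα)) Q hQ3
  have h2 : (2 : ℝ) * (cayley (multiplesUpToHalf p S) (hS.multiplesUpToHalf p)).cut Q ≤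
      ((p / 2 : ℕ) : ℝ) * (((p / 2 : ℕ) : ℝ) + 1) * (cayley S hS).cut Q := by
    exact_mod_cast two_mul_cut_multiplesUpToHalf_le hS p Q
  have h3 := h1.trans h2
  rw [card_multiplesUpToHalf] at h3
  have hQ' : (0 : ℝ) < (Q.card : ℝ) * S.card := by exact_mod_cast hQ
  rw [MultiGraph.setConductance, cayley_vol, Nat.cast_mul, div_le_div_iff₀ (by positivity) hQ']
  refine le_of_mul_le_mul_left ?_ hm
  rw [Nat.cast_mul] at h3
  linarith

theorem conductance_nonneg (hS : SymmGens S) : 0 ≤ (cayley S hS).conductance := by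
  refine Real.sInf_nonneg ?_
  rintro x ⟨Q, -, -, rfl⟩
  exact div_nonneg (Nat.cast_nonneg _) (Nat.cast_nonneg _)

end Conductance

/-! ### The output of the program -/

section Output

open Matrix RAM

variable {p n : ℕ}

theorem le_minCount {m M k b : ℕ} {data : ℕ → ℕ} (hm : b ≤ m)
    (h : ∀ i < k, b ≤ nonzeroCount p n (M - i) data m) : b ≤ minCount p n m data M k := by
  induction k with
  | zero => exact hm
  | succ k ih => exact le_min (ih fun i hi => h i (by omega)) (h k (by omega))

theorem minCount_le_nonzeroCount {m M k i : ℕ} {data : ℕ → ℕ} (hi : i < k) :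
    minCount p n m data M k ≤ nonzeroCount p n (M - i) data m := by
  induction k with
  | zero => omega
  | succ k ih =>
    rcases Nat.lt_succ_iff_lt_or_eq.1 hi with hi | rfl
    · exact (min_le_left _ _).trans (ih hi)
    · exact min_le_right _ _

/-- The vector of the `n` lowest base `p` digits of `c`. -/
def digitVec (p n c : ℕ) : Fin n → ZMod p := fun i => ((c / p ^ (i : ℕ) % p : ℕ) : ZMod p)

/-- The coordinates of a list of vectors, as they are listed on the input tape. -/
def coordinates (gens : List (Fin n → ZMod p)) : List ℕ :=
  gens.flatMap fun s => List.ofFn fun j => (s j).val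

theorem length_coordinates (gens : List (Fin n → ZMod p)) :
    (coordinates gens).length = gens.length * n := by
  simp [coordinates, List.length_flatMap]

variable [Fact p.Prime]

theorem le_of_mem_coordinates {gens : List (Fin n → ZMod p)} {x : ℕ} (hx : x ∈ coordinates gens) :
    x ≤ p := by
  simp only [coordinates, List.mem_flatMap, List.mem_ofFn] at hx
  obtain ⟨s, -, j, rfl⟩ := hx
  exact (ZMod.val_lt _).le

theorem digitDot_mod_eq_zero_iff (c : ℕ) (d : ℕ → ℕ) (s : Fin n → ZMod p)
    (h : ∀ i : Fin n, d i = (s i).val) :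
    digitDot p c d n % p = 0 ↔ digitVec p n c ⬝ᵥ s = 0 := by
  rw [← Nat.dvd_iff_mod_eq_zero, ← ZMod.natCast_eq_zero_iff, digitDot, Finset.sum_range]
  simp [dotProduct, digitVec, h]

theorem nonzeroCount_eq_countP (c : ℕ) (gens : List (Fin n → ZMod p)) :
    nonzeroCount p n c (fun a => (coordinates gens).getD a 0) gens.length =
      (gens : Multiset (Fin n → ZMod p)).countP (fun s => digitVec p n c ⬝ᵥ s ≠ 0) := by
  rw [Multiset.coe_countP]
  induction gens with
  | nil => simp [nonzeroCount]
  | cons s gens ih =>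
    have hcons : coordinates (s :: gens) = List.ofFn (fun j => (s j).val) ++ coordinates gens := by
      simp [coordinates]
    have hhead : ∀ i : Fin n, (coordinates (s :: gens)).getD (0 * n + i) 0 = (s i).val := by
      intro i
      rw [hcons, zero_mul, zero_add, List.getD_append _ _ _ _ (by simp)]
      simp
    have htail : ∀ j l, (coordinates (s :: gens)).getD ((j + 1) * n + l) 0 =
        (coordinates gens).getD (j * n + l) 0 := by
      intro j l
      rw [hcons, List.getD_append_right _ _ _ _ (by simp [Nat.add_mul]; omega)]
      congr 1
      simp [Nat.add_mul]
      omega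
    rw [nonzeroCount] at ih ⊢
    rw [List.length_cons, Finset.sum_range_succ', List.countP_cons, ← ih]
    have h0 := digitDot_mod_eq_zero_iff c
      (fun l => (coordinates (s :: gens)).getD (0 * n + l) 0) s hhead
    simp only [htail, h0]
    simp

theorem digitVec_ne_zero {c : ℕ} (hc0 : c ≠ 0) (hc : c < p ^ n) : digitVec p n c ≠ 0 := by
  intro h
  apply hc0
  have hdigit : ∀ i : Fin n, c / p ^ (i : ℕ) % p = 0 := by
    intro i
    have h1 : ((c / p ^ (i : ℕ) % p : ℕ) : ZMod p) = 0 := congrFun h i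
    rw [ZMod.natCast_eq_zero_iff] at h1
    exact Nat.eq_zero_of_dvd_of_lt h1 (Nat.mod_lt _ (Fact.out : p.Prime).pos)
  have h2 := finFunctionFinEquiv_apply (finFunctionFinEquiv.symm (⟨c, hc⟩ : Fin (p ^ n)))
  simpa [finFunctionFinEquiv_symm_apply_val, hdigit] using h2

theorem exists_digitVec_eq {α : Fin n → ZMod p} (hα : α ≠ 0) :
    ∃ c, c ≠ 0 ∧ c < p ^ n ∧ digitVec p n c = α := by
  let c := finFunctionFinEquiv (fun i => (⟨(α i).val, ZMod.val_lt _⟩ : Fin p))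
  have hc : digitVec p n c = α := by
    funext i
    have h := finFunctionFinEquiv_symm_apply_val c i
    rw [Equiv.symm_apply_apply] at h
    rw [digitVec, ← h]
    simp
  refine ⟨c, fun h0 => hα ?_, c.2, hc⟩
  rw [← hc, h0]
  funext i
  simp [digitVec]

theorem minCount_eq {gens : List (Fin n → ZMod p)} {α₁ : Fin n → ZMod p} (hα₁ : α₁ ≠ 0)
    (hmin : ∀ α ≠ 0, (gens : Multiset (Fin n → ZMod p)).countP (fun s => α₁ ⬝ᵥ s ≠ 0) ≤
      (gens : Multiset (Fin n → ZMod p)).countP (fun s => α ⬝ᵥ s ≠ 0)) :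
    minCount p n gens.length (fun a => (coordinates gens).getD a 0) (p ^ n - 1) (p ^ n - 1) =
      (gens : Multiset (Fin n → ZMod p)).countP (fun s => α₁ ⬝ᵥ s ≠ 0) := by
  apply le_antisymm
  · obtain ⟨c, hc0, hc, rfl⟩ := exists_digitVec_eq hα₁
    have h := minCount_le_nonzeroCount (p := p) (n := n) (m := gens.length) (M := p ^ n - 1)
      (k := p ^ n - 1) (i := p ^ n - 1 - c) (data := fun a => (coordinates gens).getD a 0)
      (by omega)
    rwa [show p ^ n - 1 - (p ^ n - 1 - c) = c by omega, nonzeroCount_eq_countP] at h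
  · refine le_minCount ?_ fun i hi => ?_
    · exact Multiset.countP_le_card _ _
    · rw [nonzeroCount_eq_countP]
      exact hmin _ (digitVec_ne_zero (by omega) (by omega))

end Output

theorem mainTheorem10 :
    ∃ (A : RAM.Program) (T : Polynomial ℕ) (C : ℝ), 0 < C ∧
      ∀ (p n : ℕ) [Fact p.Prime] (_ : 1 ≤ n) (gens : List (Fin n → ZMod p)) (_ : gens ≠ [])
        (hS : SymmGens (gens : Multiset (Fin n → ZMod p))),
        let G := cayley (gens : Multiset (Fin n → ZMod p)) hS
        let G' := cayley (multiplesUpToHalf p (gens : Multiset (Fin n → ZMod p)))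
          (hS.multiplesUpToHalf p)
        (∃ a b : ℕ, 0 < b ∧ G'.lambda 2 = (a : ℝ) / (b : ℝ) ∧
          RAM.OutputsWithin A (encodeGens gens) [a, b] (T.eval (p ^ n + gens.length))) ∧
        G.conductance ≤ G'.lambda 2 ∧
        G'.lambda 2 ≤ C * (p : ℝ) * G.conductance ∧
        (p ≠ 2 → G'.lambda 2 ≤ ((p : ℝ) + 1) / 2 * G.conductance) := by
  refine ⟨RAM.mainCmd.compile 0, Polynomial.C 1000 * Polynomial.X ^ 5, 1, one_pos, ?_⟩
  intro p n _ hn gens hgens hS G G'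
  have hp : p.Prime := Fact.out
  have h0 : (gens : Multiset (Fin n → ZMod p)).card ≠ 0 := by
    simpa using hgens
  have : NeZero n := ⟨by omega⟩
  -- The hyperplane containing the largest number of generators.
  obtain ⟨α₁, hα₁, hmin⟩ := Set.exists_min_image {α : Fin n → ZMod p | α ≠ 0}
    (fun α => (gens : Multiset (Fin n → ZMod p)).countP (fun s => α ⬝ᵥ s ≠ 0)) (Set.toFinite _)
    ⟨Pi.single 0 1, by simp⟩
  have hlam : G'.lambda 2 = enlargedEigenvalue (gens : Multiset (Fin n → ZMod p)) α₁ :=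
    enlarged_lambda_two hS h0 hα₁ hmin
  have hupper := enlargedEigenvalue_le hS h0 hα₁ hmin
  rw [← hlam] at hupper
  have hφ : 0 ≤ G.conductance := conductance_nonneg hS
  refine ⟨⟨(gens : Multiset (Fin n → ZMod p)).countP (fun s => α₁ ⬝ᵥ s ≠ 0) * p,
    (p - 1) * gens.length, ?_, ?_, ?_⟩, ?_, ?_, ?_⟩
  · exact Nat.mul_pos (Nat.sub_pos_of_lt hp.one_lt) (List.length_pos_of_ne_nil hgens)
  · rw [hlam, enlargedEigenvalue, Multiset.coe_card]
    push_cast [hp.one_le]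
    rw [mul_comm (p : ℝ)]
  · have h := RAM.mainCmd_outputsWithin p n gens.length (p ^ n + gens.length) (coordinates gens)
      hp.pos (length_coordinates gens) (fun x hx => le_of_mem_coordinates hx)
      ((Nat.le_self_pow (by omega) p).trans (Nat.le_add_right _ _))
      ((Nat.lt_pow_self hp.one_lt).le.trans (Nat.le_add_right _ _))
      (Nat.le_add_left _ _) (Nat.le_add_right _ _)
    rw [minCount_eq hα₁ hmin] at h
    simpa [encodeGens, coordinates] using h
  · rw [hlam]
    exact conductance_le_enlargedEigenvalue hS h0 hα₁
  · refine hupper.trans (mul_le_mul_of_nonneg_right ?_ hφ)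
    have := hp.two_le
    have h : p / 2 + 1 ≤ p := by omega
    rw [one_mul]
    exact_mod_cast h
  · intro hp2
    have hodd := hp.eq_two_or_odd.resolve_left hp2
    have h : (p : ℝ) = 2 * ((p / 2 : ℕ) : ℝ) + 1 := by
      have : p = 2 * (p / 2) + 1 := by omega
      exact_mod_cast this
    have h' : ((p : ℝ) + 1) / 2 = ((p / 2 : ℕ) : ℝ) + 1 := by linarith
    rw [h']
    exact hupper
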